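/- \textbf{Setting.} Let $H_1,H_2$ be separable complex Hilbert spaces, $\Omega_1,\Omega_2$ (possibly unbounded) self-adjoint operators in $H_1,H_2$, and $\Gamma:H_2\to H_1$ a bounded operator. On $\mathcal H=H_1\oplus H_2$ let $$\Omega=\begin{pmatrix}\Omega_1&\Gamma\\ \Gamma^\dagger&\Omega_2\end{pmatrix},\qquad \mathrm{Dom}\,\Omega=\mathrm{Dom}\,\Omega_1\oplus\mathrm{Dom}\,\Omega_2 .$$ For a self-adjoint operator $A$ and a set $S$ of vectors, $\mathcal O_A(S)$ is the closure of $\mathrm{span}\{f(A)w: f\in C_c(\mathbb R),\,w\in S\}$; a subspace $K$ is $A$-invariant if $\mathcal O_A(K)=K$. An \emph{s-invariant decomposition} is $\mathcal H=\bigoplus_\alpha(H_{1\alpha}\oplus H_{2\alpha})$, where $H_1=\bigoplus_\alpha H_{1\alpha}$ and $H_2=\bigoplus_\alpha H_{2\alpha}$ are (finite or infinite) orthogonal decompositions into closed subspaces and each $H_{1\alpha}\oplus H_{2\alpha}$ is $\Omega$-invariant. The system $(\mathcal H,\Omega)$ is \emph{reconstructible} if it is the minimal conservative extension of each of the two open systems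 obtained by projecting its dynamics to $H_1$ and to $H_2$, that is, $\mathcal O_\Omega(H_1)=\mathcal H=\mathcal O_\Omega(H_2)$. A \emph{singular-vector decomposition} of $\Gamma$ is a strongly convergent representation $$\Gamma=\sum_{q}\sqrt{\gamma_q}\,|g_q\rangle\langle g'_q|,\qquad \gamma_q>0,\quad \langle g_p|g_q\rangle=\langle g'_p|g'_q\rangle=\delta_{pq},$$ over a countable (possibly infinite or empty) index set. Let $U:\overline{\mathrm{Ran}\,\Gamma}\to\overline{\mathrm{Ran}\,\Gamma^\dagger}$ be the isometry of the polar decomposition $\Gamma^\dagger=U(\Gamma\Gamma^\dagger)^{1/2}$, let $H_0$ be a Hilbert space with unitary maps $U_1:H_0\to\overline{\mathrm{Ran}\,\Gamma}$ and $U_2:H_0\to\overline{\mathrm{Ran}\,\Gamma^\dagger}$ such that $U_2U_1^{-1}=U$, and let $\Gamma_0=U_1^{-1}\Gamma U_2=U_2^{-1}\Gamma^\dagger U_1$ on $H_0$. Assume that $\Gamma_0$ has pure point spectrum, i.e. its eigenvectors span a dense subspace of $H_0$. \textbf{Theorem.} \begin{enumerate} \item For every s-invariant decomposition $\mathcal H=\bigoplus_\alpha(H_{1\alpha}\oplus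 H_{2\alpha})$ there are $\gamma_q>0$ and an orthonormal family $(g_{0q})$ in $H_0$ with $\Gamma_0=\sum_q\sqrt{\gamma_q}\,|g_{0q}\rangle\langle g_{0q}|$ such that, with $g_q=U_1g_{0q}$ and $g'_q=U_2g_{0q}$, $\Gamma=\sum_q\sqrt{\gamma_q}\,|g_q\rangle\langle g'_q|$ is a singular-vector decomposition of $\Gamma$ and for every $q$ there is an $\alpha$ with $g_q\in H_{1\alpha}$ and $g'_q\in H_{2\alpha}$. \item Conversely, assume that $(\mathcal H,\Omega)$ is reconstructible and let an arbitrary singular-vector decomposition of $\Gamma$ be given. Let $G$ be the graph on the index set in which distinct $p,q$ are joined if and only if $\mathcal O_{\Omega_1}(g_p)\not\perp g_q$ or $\mathcal O_{\Omega_2}(g'_p)\not\perp g'_q$ (a symmetric condition). Let $V_\alpha$ be the vertex sets of the connected components of $G$, and put $H_{1\alpha}=\mathcal O_{\Omega_1}(\{g_q:q\in V_\alpha\})$, $H_{2\alpha}=\mathcal O_{\Omega_2}(\{g'_q:q\in V_\alpha\})$. Then \begin{enumerate} \item $\mathcal H=\bigoplus_\alpha(H_{1\alpha}\oplus H_{2\alpha})$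 is an s-invariant decomposition; \item it is the finest one such that each $g_q$ is in one of the $H_{1\alpha}$: it has this property, and if $\mathcal H=\bigoplus_\beta(H_1^\beta\oplus H_2^\beta)$ is any s-invariant decomposition with each $g_q$ in one of the $H_1^\beta$, then for every $\alpha$ there is a $\beta$ with $H_{i\alpha}\subset H_i^\beta$ for $i=1,2$. \end{enumerate} \item If $(\mathcal H,\Omega)$ is reconstructible and every eigenspace of $\Gamma\Gamma^\dagger$ for a nonzero eigenvalue is one-dimensional, then there is a unique finest s-invariant decomposition of $(\mathcal H,\Omega)$: there is exactly one s-invariant decomposition $\bigoplus_\alpha(H_{1\alpha}\oplus H_{2\alpha})$ into nonzero summands (up to the labelling of the summands) such that, for every s-invariant decomposition $\bigoplus_\beta(H_1^\beta\oplus H_2^\beta)$ and every $\alpha$, there is a $\beta$ with $H_{i\alpha}\subset H_i^\beta$ for $i=1,2$. \end{enumerate} -/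

import Mathlib

open scoped InnerProductSpace ComplexConjugate

noncomputable section

namespace OpenSystem

section Calculus

variable {H : Type*} [NormedAddCommGroup H] [InnerProductSpace ℂ H] [CompleteSpace H]

/-- `R` is the everywhere defined bounded operator `(A + i)⁻¹`, for a partially defined
operator `A`. -/
structure IsResolvent (A : H →ₗ.[ℂ] H) (R : H →L[ℂ] H) : Prop where
  right : ∀ x : H, ∃ h : R x ∈ A.domain, A ⟨R x, h⟩ + Complex.I • R x = x
  left : ∀ y : A.domain, R (A y + Complex.I • (y : H)) = y

/-- For a (possibly unbounded) self-adjoint operator `A`, the bounded operator `(A + i)⁻¹` exists,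
so that `resolventI A` below never takes its default value. -/
theorem exists_isResolvent {A : H →ₗ.[ℂ] H} (hA : IsSelfAdjoint A) :
    ∃ R : H →L[ℂ] H, IsResolvent A R := by
  have hd := hA.dense_domain
  have hadj : LinearPMap.adjoint A = A := hA
  have hsym : ∀ x y : A.domain, ⟪A x, (y : H)⟫_ℂ = ⟪(x : H), A y⟫_ℂ := by
    have h := LinearPMap.adjoint_isFormalAdjoint (T := A) hd
    rw [hadj] at h
    intro x y
    exact h x y
  let T : A.domain →ₗ[ℂ] H := A.toFun + Complex.I • A.domain.subtype
  have hT : ∀ y, T y = A y + Complex.I • (y : H) := fun y => rfl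
  have hnorm : ∀ y, ‖T y‖ ^ 2 = ‖A y‖ ^ 2 + ‖(y : H)‖ ^ 2 := by
    intro y
    have him : (⟪A y, (y : H)⟫_ℂ).im = 0 := by
      have h1 := hsym y y
      have h2 := inner_conj_symm (𝕜 := ℂ) (A y) (y : H)
      rw [← h1] at h2
      exact Complex.conj_eq_iff_im.1 h2
    rw [hT, norm_add_sq (𝕜 := ℂ), inner_smul_right, norm_smul]
    simp [him]
  have hbd : ∀ y : A.domain, ‖(y : H)‖ ≤ ‖T y‖ := by
    intro y
    have := hnorm y
    apply le_of_sq_le_sq _ (norm_nonneg _)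
    nlinarith [sq_nonneg ‖A y‖]
  have hbdA : ∀ y : A.domain, ‖A y‖ ≤ ‖T y‖ := by
    intro y
    have := hnorm y
    apply le_of_sq_le_sq _ (norm_nonneg _)
    nlinarith [sq_nonneg ‖(y : H)‖]
  have hinj : Function.Injective T := by
    rw [← LinearMap.ker_eq_bot, LinearMap.ker_eq_bot']
    intro y hy
    have := hbd y
    rw [hy, norm_zero, norm_le_zero_iff] at this
    exact_mod_cast this
  have hperp : (LinearMap.range T)ᗮ = ⊥ := by
    rw [Submodule.eq_bot_iff]
    intro z hz
    have hz' : ∀ y : A.domain, ⟪Complex.I • z, (y : H)⟫_ℂ = ⟪z, A y⟫_ℂ := by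
      intro y
      have := (Submodule.mem_orthogonal' _ z).1 hz (T y) ⟨y, rfl⟩
      rw [hT, inner_add_right, inner_smul_right] at this
      rw [inner_smul_left, Complex.conj_I]
      linear_combination -this
    have hmem : z ∈ (LinearPMap.adjoint A).domain :=
      LinearPMap.mem_adjoint_domain_of_exists (T := A) z ⟨_, hz'⟩
    have hval : LinearPMap.adjoint A ⟨z, hmem⟩ = Complex.I • z :=
      LinearPMap.adjoint_apply_eq (T := A) hd ⟨z, hmem⟩ hz'
    have hmem' : z ∈ A.domain := by rw [hadj] at hmem; exact hmem
    have hval' : A ⟨z, hmem'⟩ = Complex.I • z := by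
      rw [← hval]
      exact ((LinearPMap.ext_iff.1 hadj).2 (hf := hmem) (hg := hmem')).symm
    have h3 := hsym ⟨z, hmem'⟩ ⟨z, hmem'⟩
    rw [hval', inner_smul_left, inner_smul_right, Complex.conj_I] at h3
    have h4 : ⟪z, z⟫_ℂ = 0 := by
      have : (2 * Complex.I) * ⟪z, z⟫_ℂ = 0 := by linear_combination -h3
      simpa using this
    exact inner_self_eq_zero.1 h4
  have hclosed : IsClosed (LinearMap.range T : Set H) := by
    rw [← isSeqClosed_iff_isClosed]
    intro u a hu hua
    choose y hy using hu
    have hcau : CauchySeq fun n => T (y n) := by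
      have : (fun n => T (y n)) = u := funext hy
      rw [this]; exact hua.cauchySeq
    have hc1 : CauchySeq fun n => ((y n : A.domain) : H) := by
      rw [Metric.cauchySeq_iff] at hcau ⊢
      intro ε hε
      obtain ⟨N, hN⟩ := hcau ε hε
      refine ⟨N, fun m hm n hn => lt_of_le_of_lt ?_ (hN m hm n hn)⟩
      rw [dist_eq_norm, dist_eq_norm, ← map_sub]
      exact hbd (y m - y n)
    have hc2 : CauchySeq fun n => A (y n) := by
      rw [Metric.cauchySeq_iff] at hcau ⊢
      intro ε hε
      obtain ⟨N, hN⟩ := hcau ε hε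
      refine ⟨N, fun m hm n hn => lt_of_le_of_lt ?_ (hN m hm n hn)⟩
      rw [dist_eq_norm, dist_eq_norm, ← LinearPMap.map_sub, ← map_sub]
      exact hbdA (y m - y n)
    obtain ⟨b, hb⟩ := cauchySeq_tendsto_of_complete hc1
    obtain ⟨c, hc⟩ := cauchySeq_tendsto_of_complete hc2
    have hgr : (b, c) ∈ A.graph := by
      have hcl : IsClosed (A.graph : Set (H × H)) := hA.isClosed
      refine hcl.mem_of_tendsto (hb.prodMk_nhds hc) (Filter.Eventually.of_forall fun n => ?_)
      exact LinearPMap.mem_graph A (y n)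
    rw [LinearPMap.mem_graph_iff] at hgr
    obtain ⟨w, hw1, hw2⟩ := hgr
    refine ⟨w, tendsto_nhds_unique ?_ hua⟩
    have : u = fun n => A (y n) + Complex.I • ((y n : A.domain) : H) := funext fun n => (hy n).symm
    rw [this, hT]
    simp only at hw1 hw2
    rw [hw1, hw2]
    exact hc.add (hb.const_smul _)
  have hsurj : LinearMap.range T = ⊤ := by
    have h1 := Submodule.topologicalClosure_eq_top_iff.2 hperp
    rwa [IsClosed.submodule_topologicalClosure_eq hclosed] at h1
  let e : A.domain ≃ₗ[ℂ] H := LinearEquiv.ofBijective T ⟨hinj, LinearMap.range_eq_top.1 hsurj⟩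
  have he : ∀ x, T (e.symm x) = x := fun x => e.apply_symm_apply x
  refine ⟨(A.domain.subtype ∘ₗ (e.symm : H →ₗ[ℂ] A.domain)).mkContinuous 1 ?_, ?_, ?_⟩
  · intro x
    have := hbd (e.symm x)
    rw [he] at this
    simpa using this
  · intro x
    exact ⟨(e.symm x).2, he x⟩
  · intro y
    change ((e.symm (T y) : A.domain) : H) = y
    congr 1
    exact e.symm_apply_apply y

open Classical in
/-- The bounded operator `(A + i)⁻¹`. -/
def resolventI (A : H →ₗ.[ℂ] H) : H →L[ℂ] H :=
  if h : ∃ R, IsResolvent A R then h.choose else 0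

theorem isResolvent_resolventI {A : H →ₗ.[ℂ] H} (hA : IsSelfAdjoint A) :
    IsResolvent A (resolventI A) := by
  have h := exists_isResolvent hA
  rw [resolventI, dif_pos h]
  exact h.choose_spec

open Classical in
/-- The operator `f(A)` for a self-adjoint operator `A` (possibly unbounded) and a continuous
function `f` with compact support in `ℝ`. It is obtained from the continuous functional calculus of
the bounded normal operator `R = (A + i)⁻¹`: as `A = R⁻¹ - i`, the function of `R` to be taken is
`z ↦ f (z⁻¹ - i)`, extended by zero to `z = 0` (the point at infinity of the spectrum of `A`). On
the spectrum of `R` the number `z⁻¹ - i` is real for `z ≠ 0`. -/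
def functionOf (A : H →ₗ.[ℂ] H) (f : ℝ → ℂ) : H →L[ℂ] H :=
  cfc (fun z : ℂ => if z = 0 then 0 else f (z⁻¹ - Complex.I).re) (resolventI A)

/-- The closed orbit of `S` under the self-adjoint operator `A`: the closed span of all `f(A) w`
with `f` continuous of compact support and `w ∈ S`. -/
def orbit (A : H →ₗ.[ℂ] H) (S : Set H) : Submodule ℂ H :=
  (Submodule.span ℂ {x : H | ∃ f : ℝ → ℂ, Continuous f ∧ HasCompactSupport f ∧
    ∃ w ∈ S, x = functionOf A f w}).topologicalClosure

/-- `K` is invariant with respect to `A`. (This includes that `K` is closed.) -/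
def IsInvariant (A : H →ₗ.[ℂ] H) (K : Submodule ℂ H) : Prop :=
  orbit A (K : Set H) = K

/-- A bounded operator has pure point spectrum if its eigenvectors span a dense subspace; for a
self-adjoint operator this says that there is an orthonormal basis of eigenvectors. -/
def HasPurePointSpectrum (T : H →L[ℂ] H) : Prop :=
  (⨆ μ : ℂ, Module.End.eigenspace (T : Module.End ℂ H) μ).topologicalClosure = ⊤

/-- `H` is the orthogonal (Hilbert space) direct sum of the closed subspaces `K α`. -/
structure IsOrthogonalDecomposition {κ : Type*} (K : κ → Submodule ℂ H) : Prop where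
  closed : ∀ α, IsClosed (K α : Set H)
  ortho : ∀ α β, α ≠ β → K α ⟂ K β
  total : (⨆ α, K α).topologicalClosure = ⊤

end Calculus

section System

variable {H₁ H₂ : Type*}
  [NormedAddCommGroup H₁] [InnerProductSpace ℂ H₁] [CompleteSpace H₁]
  [NormedAddCommGroup H₂] [InnerProductSpace ℂ H₂] [CompleteSpace H₂]

/-- The subspace `K₁ ⊕ K₂` of the Hilbert space `H₁ ⊕ H₂`. -/
def directSum (K₁ : Submodule ℂ H₁) (K₂ : Submodule ℂ H₂) : Submodule ℂ (WithLp 2 (H₁ × H₂)) where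
  carrier := {x | x.fst ∈ K₁ ∧ x.snd ∈ K₂}
  add_mem' hx hy := ⟨K₁.add_mem hx.1 hy.1, K₂.add_mem hx.2 hy.2⟩
  zero_mem' := ⟨K₁.zero_mem, K₂.zero_mem⟩
  smul_mem' c _ hx := ⟨K₁.smul_mem c hx.1, K₂.smul_mem c hx.2⟩

/-- The frequency operator `Ω = [[Ω₁, Γ], [Γ†, Ω₂]]` in `H₁ ⊕ H₂`, with domain
`Dom Ω₁ ⊕ Dom Ω₂`. -/
def frequencyOperator (Ω₁ : H₁ →ₗ.[ℂ] H₁) (Ω₂ : H₂ →ₗ.[ℂ] H₂) (Γ : H₂ →L[ℂ] H₁) :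
    WithLp 2 (H₁ × H₂) →ₗ.[ℂ] WithLp 2 (H₁ × H₂) where
  domain := directSum Ω₁.domain Ω₂.domain
  toFun :=
    { toFun := fun x => WithLp.toLp 2
        (Ω₁ ⟨x.1.fst, x.2.1⟩ + Γ x.1.snd, ContinuousLinearMap.adjoint Γ x.1.fst + Ω₂ ⟨x.1.snd, x.2.2⟩)
      map_add' := by
        intro x y
        have h1 : Ω₁ ⟨(x + y).1.fst, (x + y).2.1⟩ =
            Ω₁ ⟨x.1.fst, x.2.1⟩ + Ω₁ ⟨y.1.fst, y.2.1⟩ := by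
          rw [← LinearPMap.map_add]; rfl
        have h2 : Ω₂ ⟨(x + y).1.snd, (x + y).2.2⟩ =
            Ω₂ ⟨x.1.snd, x.2.2⟩ + Ω₂ ⟨y.1.snd, y.2.2⟩ := by
          rw [← LinearPMap.map_add]; rfl
        rw [h1, h2, ← WithLp.toLp_add]
        congr 1
        ext
        · simp only [Submodule.coe_add, WithLp.add_snd, map_add, Prod.fst_add]; abel
        · simp only [Submodule.coe_add, WithLp.add_fst, map_add, Prod.snd_add]; abel
      map_smul' := by
        intro c x
        have h1 : Ω₁ ⟨(c • x).1.fst, (c • x).2.1⟩ = c • Ω₁ ⟨x.1.fst, x.2.1⟩ := by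
          rw [← LinearPMap.map_smul]; rfl
        have h2 : Ω₂ ⟨(c • x).1.snd, (c • x).2.2⟩ = c • Ω₂ ⟨x.1.snd, x.2.2⟩ := by
          rw [← LinearPMap.map_smul]; rfl
        rw [h1, h2, RingHom.id_apply, ← WithLp.toLp_smul]
        congr 1
        ext
        · simp
        · simp }

theorem mem_domain_of_isSelfAdjoint {H : Type*} [NormedAddCommGroup H] [InnerProductSpace ℂ H]
    [CompleteSpace H] {A : H →ₗ.[ℂ] H} (hA : IsSelfAdjoint A) (y w : H)
    (h : ∀ x : A.domain, ⟪w, (x : H)⟫_ℂ = ⟪y, A x⟫_ℂ) : y ∈ A.domain := by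
  have hadj : LinearPMap.adjoint A = A := hA
  have := LinearPMap.mem_adjoint_domain_of_exists (T := A) y ⟨w, h⟩
  rwa [hadj] at this

theorem inner_of_isSelfAdjoint {H : Type*} [NormedAddCommGroup H] [InnerProductSpace ℂ H]
    [CompleteSpace H] {A : H →ₗ.[ℂ] H} (hA : IsSelfAdjoint A) (x y : A.domain) :
    ⟪A x, (y : H)⟫_ℂ = ⟪(x : H), A y⟫_ℂ := by
  have hadj : LinearPMap.adjoint A = A := hA
  have h := LinearPMap.adjoint_isFormalAdjoint (T := A) hA.dense_domain
  rw [hadj] at h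
  exact h x y

/-- The frequency operator is self-adjoint. -/
theorem isSelfAdjoint_frequencyOperator {Ω₁ : H₁ →ₗ.[ℂ] H₁} (h₁ : IsSelfAdjoint Ω₁)
    {Ω₂ : H₂ →ₗ.[ℂ] H₂} (h₂ : IsSelfAdjoint Ω₂) (Γ : H₂ →L[ℂ] H₁) :
    IsSelfAdjoint (frequencyOperator Ω₁ Ω₂ Γ) := by
  set T := frequencyOperator Ω₁ Ω₂ Γ with hT
  have hval : ∀ x : T.domain, T x = WithLp.toLp 2
      (Ω₁ ⟨x.1.fst, x.2.1⟩ + Γ x.1.snd, ContinuousLinearMap.adjoint Γ x.1.fst + Ω₂ ⟨x.1.snd, x.2.2⟩) :=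
    fun x => rfl
  have hd : Dense (T.domain : Set (WithLp 2 (H₁ × H₂))) := by
    have hp := h₁.dense_domain.prod h₂.dense_domain
    exact (hp.preimage (WithLp.prodContinuousLinearEquiv 2 ℂ H₁ H₂).toHomeomorph.isOpenMap)
  have hin : ∀ u v : WithLp 2 (H₁ × H₂), ⟪u, v⟫_ℂ = ⟪u.fst, v.fst⟫_ℂ + ⟪u.snd, v.snd⟫_ℂ :=
    fun u v => rfl
  have hsym : T.IsFormalAdjoint T := by
    intro x y
    have e1 := inner_of_isSelfAdjoint h₁ ⟨x.1.fst, x.2.1⟩ ⟨y.1.fst, y.2.1⟩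
    have e2 := inner_of_isSelfAdjoint h₂ ⟨x.1.snd, x.2.2⟩ ⟨y.1.snd, y.2.2⟩
    rw [hval, hval, hin, hin]
    generalize Ω₁ ⟨x.1.fst, x.2.1⟩ = a1 at *
    generalize Ω₁ ⟨y.1.fst, y.2.1⟩ = b1 at *
    generalize Ω₂ ⟨x.1.snd, x.2.2⟩ = a2 at *
    generalize Ω₂ ⟨y.1.snd, y.2.2⟩ = b2 at *
    change ⟪a1 + Γ x.1.snd, y.1.fst⟫_ℂ + ⟪ContinuousLinearMap.adjoint Γ x.1.fst + a2, y.1.snd⟫_ℂ =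
      ⟪x.1.fst, b1 + Γ y.1.snd⟫_ℂ + ⟪x.1.snd, ContinuousLinearMap.adjoint Γ y.1.fst + b2⟫_ℂ
    simp only [inner_add_left, inner_add_right, ContinuousLinearMap.adjoint_inner_left,
      ContinuousLinearMap.adjoint_inner_right]
    linear_combination e1 + e2
  have hle : T ≤ LinearPMap.adjoint T := LinearPMap.IsFormalAdjoint.le_adjoint hd hsym
  have hdom : (LinearPMap.adjoint T).domain ≤ T.domain := by
    intro y hy
    have key := LinearPMap.adjoint_isFormalAdjoint hd ⟨y, hy⟩
    set z := LinearPMap.adjoint T ⟨y, hy⟩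
    constructor
    · refine mem_domain_of_isSelfAdjoint h₁ y.fst (z.fst - Γ y.snd) fun x => ?_
      have k := key ⟨WithLp.toLp 2 ((x : H₁), (0 : H₂)), x.2, Ω₂.domain.zero_mem⟩
      have h0 : Ω₂ ⟨0, Ω₂.domain.zero_mem⟩ = 0 := Ω₂.map_zero
      rw [hval, hin, hin] at k
      change ⟪z.fst, (x : H₁)⟫_ℂ + ⟪z.snd, (0 : H₂)⟫_ℂ = ⟪y.fst, Ω₁ x + Γ 0⟫_ℂ +
        ⟪y.snd, ContinuousLinearMap.adjoint Γ x + Ω₂ ⟨0, Ω₂.domain.zero_mem⟩⟫_ℂ at k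
      rw [h0, map_zero, add_zero, add_zero, inner_zero_right, add_zero,
        ContinuousLinearMap.adjoint_inner_right] at k
      rw [inner_sub_left, k, add_sub_cancel_right]
    · refine mem_domain_of_isSelfAdjoint h₂ y.snd
        (z.snd - ContinuousLinearMap.adjoint Γ y.fst) fun x => ?_
      have k := key ⟨WithLp.toLp 2 ((0 : H₁), (x : H₂)), Ω₁.domain.zero_mem, x.2⟩
      have h0 : Ω₁ ⟨0, Ω₁.domain.zero_mem⟩ = 0 := Ω₁.map_zero
      rw [hval, hin, hin] at k
      change ⟪z.fst, (0 : H₁)⟫_ℂ + ⟪z.snd, (x : H₂)⟫_ℂ =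
        ⟪y.fst, Ω₁ ⟨0, Ω₁.domain.zero_mem⟩ + Γ x⟫_ℂ +
        ⟪y.snd, ContinuousLinearMap.adjoint Γ 0 + Ω₂ x⟫_ℂ at k
      rw [h0, map_zero, zero_add, zero_add, inner_zero_right, zero_add] at k
      rw [inner_sub_left, k, ContinuousLinearMap.adjoint_inner_left, add_sub_cancel_left]
  exact (LinearPMap.eq_of_le_of_domain_eq hle (le_antisymm hle.1 hdom)).symm

/-- The system is reconstructible: `H₁ ⊕ H₂` is the (state space of the) minimal conservative
extension of each of the two open systems obtained by projecting the dynamics to `H₁` and to `H₂`;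
these minimal extensions are the orbits of `H₁` and of `H₂` under `Ω`. -/
structure IsReconstructible (Ω₁ : H₁ →ₗ.[ℂ] H₁) (Ω₂ : H₂ →ₗ.[ℂ] H₂) (Γ : H₂ →L[ℂ] H₁) : Prop where
  from_first : orbit (frequencyOperator Ω₁ Ω₂ Γ)
    (directSum (⊤ : Submodule ℂ H₁) (⊥ : Submodule ℂ H₂) : Set (WithLp 2 (H₁ × H₂))) = ⊤
  from_second : orbit (frequencyOperator Ω₁ Ω₂ Γ)
    (directSum (⊥ : Submodule ℂ H₁) (⊤ : Submodule ℂ H₂) : Set (WithLp 2 (H₁ × H₂))) = ⊤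

/-- `H₁ ⊕ H₂ = ⨁ α, (K₁ α ⊕ K₂ α)` is an s-invariant decomposition. Zero summands are allowed. -/
structure IsSInvariantDecomposition (Ω₁ : H₁ →ₗ.[ℂ] H₁) (Ω₂ : H₂ →ₗ.[ℂ] H₂) (Γ : H₂ →L[ℂ] H₁)
    {κ : Type*} (K₁ : κ → Submodule ℂ H₁) (K₂ : κ → Submodule ℂ H₂) : Prop where
  decomposition₁ : IsOrthogonalDecomposition K₁
  decomposition₂ : IsOrthogonalDecomposition K₂
  invariant : ∀ α, IsInvariant (frequencyOperator Ω₁ Ω₂ Γ) (directSum (K₁ α) (K₂ α))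

/-- `Γ = ∑ q, √(γ q) |g q⟩⟨g' q|`, convergent in the strong sense, with `γ q > 0` and with
orthonormal families `g` and `g'`. -/
structure IsSingularDecomposition (Γ : H₂ →L[ℂ] H₁) {ι : Type*} (γ : ι → ℝ) (g : ι → H₁)
    (g' : ι → H₂) : Prop where
  pos : ∀ q, 0 < γ q
  orthonormal_left : Orthonormal ℂ g
  orthonormal_right : Orthonormal ℂ g'
  hasSum : ∀ v : H₂, HasSum (fun q => ((Real.sqrt (γ q) : ℂ) * ⟪g' q, v⟫_ℂ) • g q) (Γ v)

/-- The standard representation of `Γ`: `H₀` is identified by unitary maps `U₁` and `U₂` with the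
closures of `Ran Γ` and `Ran Γ†`, where `U₂ U₁⁻¹` is the isometry `U` of the polar decomposition
`Γ† = U (Γ Γ†)^{1/2}`, and `Γ₀ = U₁⁻¹ Γ U₂ = U₂⁻¹ Γ† U₁`. -/
structure IsStandardRepresentation {H₀ : Type*} [NormedAddCommGroup H₀] [InnerProductSpace ℂ H₀]
    [CompleteSpace H₀] (Γ : H₂ →L[ℂ] H₁) (U₁ : H₀ →ₗᵢ[ℂ] H₁) (U₂ : H₀ →ₗᵢ[ℂ] H₂)
    (Γ₀ : H₀ →L[ℂ] H₀) : Prop where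
  range₁ : LinearMap.range U₁.toLinearMap =
    (LinearMap.range (Γ : H₂ →ₗ[ℂ] H₁)).topologicalClosure
  range₂ : LinearMap.range U₂.toLinearMap =
    (LinearMap.range (ContinuousLinearMap.adjoint Γ : H₁ →ₗ[ℂ] H₂)).topologicalClosure
  polar : ∀ (x : H₀) (y : H₁), U₁ x = CFC.sqrt (Γ ∘L ContinuousLinearMap.adjoint Γ) y →
    U₂ x = ContinuousLinearMap.adjoint Γ y
  eq₁ : ∀ x, U₁ (Γ₀ x) = Γ (U₂ x)
  eq₂ : ∀ x, U₂ (Γ₀ x) = ContinuousLinearMap.adjoint Γ (U₁ x)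

/-- The graph of the coupling channels: distinct `p` and `q` are joined if the `Ω₁`-orbit of `g p`
is not orthogonal to `g q` or the `Ω₂`-orbit of `g' p` is not orthogonal to `g' q`. -/
def channelGraph (Ω₁ : H₁ →ₗ.[ℂ] H₁) (Ω₂ : H₂ →ₗ.[ℂ] H₂) {ι : Type*} (g : ι → H₁) (g' : ι → H₂) :
    SimpleGraph ι :=
  SimpleGraph.fromRel fun p q => g q ∉ (orbit Ω₁ {g p})ᗮ ∨ g' q ∉ (orbit Ω₂ {g' p})ᗮ

/-- The orbit `O_A ({g q : q ∈ V})` for the vertex set `V` of each connected component of a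
graph on the index set of `g`. -/
def componentOrbit {H : Type*} [NormedAddCommGroup H] [InnerProductSpace ℂ H] [CompleteSpace H]
    (A : H →ₗ.[ℂ] H) {ι : Type*} (g : ι → H) (G : SimpleGraph ι) (c : G.ConnectedComponent) :
    Submodule ℂ H :=
  orbit A (g '' c.supp)

/-- `D` is a finest s-invariant decomposition: a set of pairs `(K₁, K₂)` of subspaces, not both
zero, such that `H₁ ⊕ H₂` is the s-invariant sum of the `K₁ ⊕ K₂`, and each of these summands lies
in a summand of every given s-invariant decomposition. -/
structure IsFinestDecomposition (Ω₁ : H₁ →ₗ.[ℂ] H₁) (Ω₂ : H₂ →ₗ.[ℂ] H₂) (Γ : H₂ →L[ℂ] H₁)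
    (D : Set (Submodule ℂ H₁ × Submodule ℂ H₂)) : Prop where
  sInvariant : IsSInvariantDecomposition Ω₁ Ω₂ Γ (fun p : D => p.1.1) (fun p : D => p.1.2)
  nonzero : ∀ p ∈ D, p ≠ (⊥, ⊥)
  finest : ∀ E : Set (Submodule ℂ H₁ × Submodule ℂ H₂),
    IsSInvariantDecomposition Ω₁ Ω₂ Γ (fun p : E => p.1.1) (fun p : E => p.1.2) →
    ∀ p ∈ D, ∃ q ∈ E, p.1 ≤ q.1 ∧ p.2 ≤ q.2

end System

end OpenSystem

end

/-! Write R = (A + i)⁻¹ for a self-adjoint A. The closed orbit of S under A is the smallest closed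
subspace that contains S and is mapped into itself by R and R† (`isReducing_orbit`, `orbit_le`,
`subset_orbit`). Hence a closed subspace is A-invariant exactly when its orthogonal projection
preserves Dom A and commutes with A there. For the block operator this splits: K₁ ⊕ K₂ is
Ω-invariant iff each Kᵢ is Ωᵢ-invariant, Γ K₂ ⊆ K₁ and Γ† K₁ ⊆ K₂ (`isInvariant_directSum_iff`).

Given an s-invariant decomposition, the projections onto its summands commute with ΓΓ†, and
positivity of Γ₀ turns this into: components of eigenvectors of Γ₀ are again eigenvectors. So H₀ is
the orthogonal sum of the pieces "eigenspace ∩ summand", and orthonormal bases of these pieces give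
the adapted singular vectors (`exists_isSingularDecomposition`).

Conversely, reconstructibility makes the orbits of all g_q and of all g'_q the full spaces. Channels
in different graph components have orthogonal orbits, so the component orbits decompose H₁ and H₂,
and Γ respects them. An edge forces its two channels into the same summand of any compatible
decomposition, so this one is the finest.

If the nonzero eigenvalues of ΓΓ† are simple, each g_q lies in a summand of every s-invariant
decomposition, so compatibility is automatic. Two finest decompositions refine each other and
therefore coincide. -/

noncomputable section

namespace OpenSystem

/-! ### Reducing subspaces of a bounded operator -/

section Calculus

variable {H : Type*} [NormedAddCommGroup H] [InnerProductSpace ℂ H] [CompleteSpace H]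

/-- `K` is invariant under the bounded operator `R` and its adjoint. -/
def IsReducing (R : H →L[ℂ] H) (K : Submodule ℂ H) : Prop :=
  ∀ x ∈ K, R x ∈ K ∧ ContinuousLinearMap.adjoint R x ∈ K

theorem IsReducing.orthogonal {R : H →L[ℂ] H} {K : Submodule ℂ H} (h : IsReducing R K) :
    IsReducing R Kᗮ := by
  intro x hx
  rw [Submodule.mem_orthogonal] at hx
  constructor <;> rw [Submodule.mem_orthogonal] <;> intro u hu
  · rw [← ContinuousLinearMap.adjoint_inner_left]
    exact hx _ (h u hu).2
  · rw [ContinuousLinearMap.adjoint_inner_right]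
    exact hx _ (h u hu).1

theorem IsReducing.topologicalClosure {R : H →L[ℂ] H} {K : Submodule ℂ H} (h : IsReducing R K) :
    IsReducing R K.topologicalClosure := fun _ hx =>
  ⟨map_mem_closure R.continuous hx fun y hy => (h y hy).1,
    map_mem_closure (ContinuousLinearMap.adjoint R).continuous hx fun y hy => (h y hy).2⟩

theorem IsReducing.iSup {R : H →L[ℂ] H} {κ : Type*} {K : κ → Submodule ℂ H}
    (h : ∀ i, IsReducing R (K i)) : IsReducing R (⨆ i, K i) := by
  intro x hx
  have h1 : ⨆ i, K i ≤ (⨆ i, K i).comap (R : H →ₗ[ℂ] H) :=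
    iSup_le fun i y hy => Submodule.mem_iSup_of_mem i (h i y hy).1
  have h2 : ⨆ i, K i ≤ (⨆ i, K i).comap (ContinuousLinearMap.adjoint R : H →ₗ[ℂ] H) :=
    iSup_le fun i y hy => Submodule.mem_iSup_of_mem i (h i y hy).2
  exact ⟨h1 hx, h2 hx⟩

theorem isReducing_span {R : H →L[ℂ] H} {S : Set H}
    (h : ∀ x ∈ S, R x ∈ Submodule.span ℂ S ∧ ContinuousLinearMap.adjoint R x ∈ Submodule.span ℂ S) :
    IsReducing R (Submodule.span ℂ S) := by
  intro x hx
  have h1 : Submodule.span ℂ S ≤ (Submodule.span ℂ S).comap (R : H →ₗ[ℂ] H) :=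
    Submodule.span_le.2 fun y hy => (h y hy).1
  have h2 : Submodule.span ℂ S ≤
      (Submodule.span ℂ S).comap (ContinuousLinearMap.adjoint R : H →ₗ[ℂ] H) :=
    Submodule.span_le.2 fun y hy => (h y hy).2
  exact ⟨h1 hx, h2 hx⟩

theorem isReducing_top (R : H →L[ℂ] H) : IsReducing R (⊤ : Submodule ℂ H) :=
  fun _ _ => ⟨trivial, trivial⟩

/-- The bounded operators that leave a closed reducing subspace of `R` invariant include the
closed star algebra generated by `R`. -/
theorem IsReducing.apply_mem_of_mem_elemental {R : H →L[ℂ] H} {K : Submodule ℂ H}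
    (h : IsReducing R K) (hK : IsClosed (K : Set H)) {T : H →L[ℂ] H}
    (hT : T ∈ StarAlgebra.elemental ℂ R) : IsReducing T K := by
  let S : StarSubalgebra ℂ (H →L[ℂ] H) :=
    { carrier := {T | IsReducing T K}
      mul_mem' := fun {a b} ha hb x hx => by
        refine ⟨(ha _ (hb x hx).1).1, ?_⟩
        rw [← ContinuousLinearMap.star_eq_adjoint, star_mul]
        exact (hb _ (ha x hx).2).2
      add_mem' := fun {a b} ha hb x hx => by
        refine ⟨K.add_mem (ha x hx).1 (hb x hx).1, ?_⟩
        rw [map_add]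
        exact K.add_mem (ha x hx).2 (hb x hx).2
      algebraMap_mem' := fun _ _ hx => by
        rw [← ContinuousLinearMap.star_eq_adjoint, Algebra.algebraMap_eq_smul_one, star_smul,
          star_one]
        exact ⟨K.smul_mem _ hx, K.smul_mem _ hx⟩
      star_mem' := fun {a} ha x hx => by
        rw [ContinuousLinearMap.star_eq_adjoint, ContinuousLinearMap.adjoint_adjoint]
        exact ⟨(ha x hx).2, (ha x hx).1⟩ }
  have hS : IsClosed (S : Set (H →L[ℂ] H)) := by
    have : (S : Set (H →L[ℂ] H)) =
        ⋂ x ∈ K, {T : H →L[ℂ] H | T x ∈ K} ∩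
          {T : H →L[ℂ] H | ContinuousLinearMap.adjoint T x ∈ K} := by
      ext T
      simp only [Set.mem_iInter]
      exact Iff.rfl
    rw [this]
    refine isClosed_biInter fun x _ => IsClosed.inter ?_ ?_
    · exact hK.preimage (by fun_prop)
    · refine hK.preimage (f := fun T : H →L[ℂ] H => ContinuousLinearMap.adjoint T x) ?_
      exact (ContinuousLinearMap.apply ℂ H x).continuous.comp
        (ContinuousLinearMap.adjoint (𝕜 := ℂ) (E := H) (F := H)).continuous
  exact StarAlgebra.elemental.le_of_mem hS (show R ∈ S from h) hT

/-- A closed subspace is reducing if and only if its projection commutes with the operator. -/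
theorem isReducing_iff_commute {R : H →L[ℂ] H} {K : Submodule ℂ H} [K.HasOrthogonalProjection] :
    IsReducing R K ↔ ∀ x, R (K.starProjection x) = K.starProjection (R x) := by
  constructor
  · intro h x
    refine (Submodule.eq_starProjection_of_mem_orthogonal (h _ (K.starProjection_apply_mem x)).1 ?_).symm
    rw [← map_sub]
    exact (h.orthogonal _ (K.sub_starProjection_mem_orthogonal x)).1
  · intro h x hx
    have e : K.starProjection x = x := Submodule.starProjection_eq_self_iff.2 hx
    constructor
    · rw [← e, h]
      exact K.starProjection_apply_mem _
    -- Commutation with `R` alone suffices: the projection is self-adjoint, so it also commutes with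
    -- R†.
    · have : ContinuousLinearMap.adjoint R x =
          K.starProjection (ContinuousLinearMap.adjoint R x) := by
        refine ext_inner_right ℂ fun y => ?_
        rw [K.inner_starProjection_left_eq_right, ContinuousLinearMap.adjoint_inner_left,
          ContinuousLinearMap.adjoint_inner_left, h, ← K.inner_starProjection_left_eq_right, e]
      rw [this]
      exact K.starProjection_apply_mem _

/-! ### The resolvent (A + i)⁻¹ as a normal operator -/

namespace IsResolvent

variable {A : H →ₗ.[ℂ] H} {R : H →L[ℂ] H}

omit [CompleteSpace H] in
theorem injective (hR : IsResolvent A R) : Function.Injective R := by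
  rw [← ContinuousLinearMap.coe_coe, ← LinearMap.ker_eq_bot, LinearMap.ker_eq_bot']
  intro x hx
  replace hx : R x = 0 := hx
  obtain ⟨h, e⟩ := hR.right x
  rw [← e, show (⟨R x, h⟩ : A.domain) = 0 from Subtype.ext hx, hx]
  simp

omit [CompleteSpace H] in
/-- A bounded operator commutes with the resolvent if and only if it preserves the domain and
commutes with the operator there. -/
theorem commute_iff (hR : IsResolvent A R) (T : H →L[ℂ] H) :
    (∀ x, R (T x) = T (R x)) ↔ ∀ x : A.domain, ∃ h : T x ∈ A.domain, A ⟨T x, h⟩ = T (A x) := by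
  constructor
  · intro h x
    have e := hR.left x
    have e1 := h (A x + Complex.I • (x : H))
    rw [e] at e1
    obtain ⟨hd, e2⟩ := hR.right (T (A x + Complex.I • (x : H)))
    have hd' : T x ∈ A.domain := e1 ▸ hd
    refine ⟨hd', ?_⟩
    rw [show (⟨_, hd⟩ : A.domain) = ⟨T x, hd'⟩ from Subtype.ext e1, e1, map_add, map_smul] at e2
    exact add_right_cancel e2
  · intro h x
    obtain ⟨hd, e⟩ := hR.right x
    obtain ⟨hd', e'⟩ := h ⟨R x, hd⟩
    have := hR.left ⟨T (R x), hd'⟩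
    simp only at e' this
    rw [e', ← map_smul, ← map_add, e] at this
    exact this

variable (hA : IsSelfAdjoint A) (hR : IsResolvent A R)
include hA hR

/-- R† is (A - i)⁻¹: pairing R†x with A y + i y returns ⟪x, y⟫, which puts R†x in the domain of A† =
A and fixes its image by density. -/
theorem adjoint_right (x : H) : ∃ h : ContinuousLinearMap.adjoint R x ∈ A.domain,
    A ⟨ContinuousLinearMap.adjoint R x, h⟩ = x + Complex.I • ContinuousLinearMap.adjoint R x := by
  have key : ∀ y : A.domain, ⟪x + Complex.I • ContinuousLinearMap.adjoint R x, (y : H)⟫_ℂ =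
      ⟪ContinuousLinearMap.adjoint R x, A y⟫_ℂ := by
    intro y
    have h1 : ⟪ContinuousLinearMap.adjoint R x, A y + Complex.I • (y : H)⟫_ℂ = ⟪x, (y : H)⟫_ℂ := by
      rw [ContinuousLinearMap.adjoint_inner_left, hR.left]
    rw [inner_add_right, inner_smul_right] at h1
    rw [inner_add_left, inner_smul_left, Complex.conj_I]
    linear_combination -h1
  have hm := mem_domain_of_isSelfAdjoint hA _ _ key
  refine ⟨hm, hA.dense_domain.eq_of_inner_left (𝕜 := ℂ) fun y hy => ?_⟩
  rw [key ⟨y, hy⟩]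
  exact inner_of_isSelfAdjoint hA ⟨_, hm⟩ ⟨y, hy⟩

theorem adjoint_eq (x : H) : ContinuousLinearMap.adjoint R x =
    R x + (2 * Complex.I) • R (ContinuousLinearMap.adjoint R x) := by
  obtain ⟨h, e⟩ := hR.adjoint_right hA x
  have := hR.left ⟨_, h⟩
  rw [e] at this
  refine Eq.trans this.symm ?_
  simp only [map_add, map_smul]
  module

theorem star_eq : star R = R + (2 * Complex.I) • (R * star R) :=
  ContinuousLinearMap.ext fun x => hR.adjoint_eq hA x

/-- Weak form of the resolvent identity with product R†R; `star_eq` has the product RR†. Comparing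
the two orders gives normality of `R`. -/
theorem inner_resolvent (u v : H) : ⟪R u, v⟫_ℂ - ⟪u, R v⟫_ℂ = (2 * Complex.I) * ⟪R u, R v⟫_ℂ := by
  obtain ⟨h1, e1⟩ := hR.right u
  obtain ⟨h2, e2⟩ := hR.right v
  have e := inner_of_isSelfAdjoint hA ⟨_, h1⟩ ⟨_, h2⟩
  have f1 : ⟪u, R v⟫_ℂ = ⟪A ⟨R u, h1⟩ + Complex.I • R u, R v⟫_ℂ := by rw [e1]
  have f2 : ⟪R u, v⟫_ℂ = ⟪R u, A ⟨R v, h2⟩ + Complex.I • R v⟫_ℂ := by rw [e2]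
  rw [f1, f2, inner_add_left, inner_add_right, inner_smul_left, inner_smul_right, Complex.conj_I]
  simp only at e
  linear_combination -e

theorem isStarNormal : IsStarNormal R := by
  refine ⟨?_⟩
  have h1 := hR.star_eq hA
  have h2 : star R = R + (2 * Complex.I) • (star R * R) := by
    refine ContinuousLinearMap.ext fun x => ext_inner_right ℂ fun y => ?_
    have := hR.inner_resolvent hA x y
    change ⟪ContinuousLinearMap.adjoint R x, y⟫_ℂ =
      ⟪R x + (2 * Complex.I) • ContinuousLinearMap.adjoint R (R x), y⟫_ℂ
    rw [inner_add_left, inner_smul_left, ContinuousLinearMap.adjoint_inner_left,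
      ContinuousLinearMap.adjoint_inner_left]
    simp only [map_mul, Complex.conj_I, map_ofNat]
    linear_combination -this
  have h3 := add_left_cancel (h2.symm.trans h1)
  exact smul_right_injective _ (by simp : (2 * Complex.I) ≠ 0) h3

/-- The identity R† = R + 2i RR† passes to the spectrum as z̄ = z + 2i z z̄. Division by z z̄ shows
that z⁻¹ - i equals its conjugate. -/
theorem spectrum_im {z : ℂ} (hz : z ∈ spectrum ℂ R) (h0 : z ≠ 0) :
    (z⁻¹ - Complex.I).im = 0 := by
  have := hR.isStarNormal hA
  have hc : cfc (fun z : ℂ => star z) R =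
      cfc (fun z : ℂ => z + (2 * Complex.I) • (z * star z)) R := by
    rw [cfc_add R (fun z : ℂ => z) (fun z : ℂ => (2 * Complex.I) • (z * star z)),
      cfc_smul (2 * Complex.I) (fun z : ℂ => z * star z) R,
      cfc_mul (fun z : ℂ => z) (fun z : ℂ => star z) R, cfc_star_id (R := ℂ) R, cfc_id' ℂ R]
    exact hR.star_eq hA
  have := eqOn_of_cfc_eq_cfc (R := ℂ) hc (by fun_prop) (by fun_prop) inferInstance hz
  simp only [smul_eq_mul] at this
  have h0' : star z ≠ 0 := by simpa using h0
  have e : z⁻¹ - Complex.I = star (z⁻¹ - Complex.I) := by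
    rw [star_sub, star_inv₀, show star Complex.I = -Complex.I from Complex.conj_I]
    field_simp
    linear_combination this
  exact Complex.conj_eq_iff_im.1 e.symm

end IsResolvent

/-- The function of `(A + i)⁻¹` that represents `f(A)`. -/
def resolventSymbol (f : ℝ → ℂ) (z : ℂ) : ℂ := if z = 0 then 0 else f (z⁻¹ - Complex.I).re

theorem functionOf_eq (A : H →ₗ.[ℂ] H) (f : ℝ → ℂ) :
    functionOf A f = cfc (resolventSymbol f) (resolventI A) := by
  unfold functionOf resolventSymbol
  congr

/-! ### Functions of A and closed orbits -/

section SelfAdjoint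

variable {A : H →ₗ.[ℂ] H} (hA : IsSelfAdjoint A)
include hA

theorem exists_real_of_mem_spectrum {z : ℂ} (hz : z ∈ spectrum ℂ (resolventI A)) (h0 : z ≠ 0) :
    ∃ t : ℝ, z * (t + Complex.I) = 1 ∧ ∀ f, resolventSymbol f z = f t := by
  refine ⟨(z⁻¹ - Complex.I).re, ?_, fun f => by rw [resolventSymbol, if_neg h0]⟩
  have h := (isResolvent_resolventI hA).spectrum_im hA hz h0
  have : (((z⁻¹ - Complex.I).re : ℝ) : ℂ) = z⁻¹ - Complex.I :=
    Complex.ext rfl (by rw [h]; rfl)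
  rw [this]
  field_simp
  ring

/-- Only z = 0 needs care: for z near 0 on the spectrum, |t + i| = |z|⁻¹ is large, so t has left the
support of f and the symbol vanishes. -/
theorem continuousOn_resolventSymbol {f : ℝ → ℂ} (hf : Continuous f) (hc : HasCompactSupport f) :
    ContinuousOn (resolventSymbol f) (spectrum ℂ (resolventI A)) := by
  intro z hz
  by_cases h0 : z = 0
  · subst h0
    obtain ⟨C, hC⟩ := hc.isCompact.isBounded.exists_norm_le
    -- On the support |t + i| ≤ |C| + 1, so radius (|C| + 2)⁻¹ excludes it. The absolute value
    -- covers a negative bound C, possible for empty support.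
    have hCp : 0 < |C| + 2 := by positivity
    have : resolventSymbol f =ᶠ[nhdsWithin 0 (spectrum ℂ (resolventI A))] fun _ => (0 : ℂ) := by
      have hb : Metric.ball (0 : ℂ) (|C| + 2)⁻¹ ∈ nhds (0 : ℂ) :=
        Metric.ball_mem_nhds _ (by positivity)
      filter_upwards [mem_nhdsWithin_of_mem_nhds hb, self_mem_nhdsWithin] with w hw hws
      by_cases hw0 : w = 0
      · rw [hw0, resolventSymbol, if_pos rfl]
      obtain ⟨t, ht, hft⟩ := exists_real_of_mem_spectrum hA hws hw0
      rw [hft]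
      refine image_eq_zero_of_notMem_tsupport fun hmem => ?_
      have h1 := hC t hmem
      have h2 : ‖w‖ * ‖(t : ℂ) + Complex.I‖ = 1 := by rw [← norm_mul, ht, norm_one]
      have h3 : ‖(t : ℂ) + Complex.I‖ ≤ |C| + 1 := by
        refine (norm_add_le _ _).trans ?_
        rw [Complex.norm_real, Complex.norm_I]
        linarith [le_abs_self C]
      rw [mem_ball_zero_iff, lt_inv_comm₀ (by simpa using hw0) hCp] at hw
      have h4 : ‖w‖⁻¹ = ‖(t : ℂ) + Complex.I‖ := inv_eq_of_mul_eq_one_right h2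
      linarith
    exact continuousWithinAt_const.congr_of_eventuallyEq this (if_pos rfl)
  · have : ContinuousAt (resolventSymbol f) z := by
      have h1 : ContinuousAt (fun z : ℂ => f (z⁻¹ - Complex.I).re) z :=
        hf.continuousAt.comp (Complex.continuous_re.continuousAt.comp
          ((continuousAt_inv₀ h0).sub continuousAt_const))
      refine h1.congr ?_
      filter_upwards [isOpen_ne.mem_nhds h0] with w hw
      rw [resolventSymbol, if_neg hw]
    exact this.continuousWithinAt

theorem cfc_mul_functionOf {r : ℂ → ℂ} (hr : Continuous r) {h : ℝ → ℂ}
    (hrh : ∀ (z : ℂ) (t : ℝ), z * (t + Complex.I) = 1 → r z = h t)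
    {f : ℝ → ℂ} (hf : Continuous f) (hc : HasCompactSupport f) :
    cfc r (resolventI A) * functionOf A f = functionOf A (h * f) := by
  rw [functionOf_eq, functionOf_eq, ← cfc_mul r (resolventSymbol f) (resolventI A)
    hr.continuousOn (continuousOn_resolventSymbol hA hf hc)]
  refine cfc_congr fun z hz => ?_
  by_cases h0 : z = 0
  · simp [resolventSymbol, h0]
  · obtain ⟨t, ht, hft⟩ := exists_real_of_mem_spectrum hA hz h0
    simp only [hft, hrh z t ht, Pi.mul_apply]

omit hA in
theorem add_I_ne_zero (t : ℝ) : (t : ℂ) + Complex.I ≠ 0 := fun h => by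
  simpa using congrArg Complex.im h

/-- Compactly supported continuous functions are stable under multiplication by (t + i)⁻¹ and its
conjugate, so R and R† send generators f(A)w to generators. -/
theorem isReducing_orbit (S : Set H) : IsReducing (resolventI A) (orbit A S) := by
  have hn := (isResolvent_resolventI hA).isStarNormal hA
  have hcont : Continuous fun t : ℝ => ((t : ℂ) + Complex.I)⁻¹ :=
    Continuous.inv₀ (by fun_prop) add_I_ne_zero
  refine (isReducing_span ?_).topologicalClosure
  rintro _ ⟨f, hf, hc, w, hw, rfl⟩
  constructor
  · refine Submodule.subset_span ⟨_, hcont.mul hf, hc.mul_left, w, hw, ?_⟩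
    rw [← cfc_mul_functionOf hA continuous_id ?_ hf hc, cfc_id ℂ (resolventI A)]
    · rfl
    · exact fun z t ht => eq_inv_of_mul_eq_one_left ht
  · refine Submodule.subset_span ⟨_, (continuous_star.comp hcont).mul hf, hc.mul_left, w, hw, ?_⟩
    rw [← cfc_mul_functionOf hA continuous_star ?_ hf hc,
      cfc_star_id (R := ℂ) (resolventI A)]
    · rfl
    · exact fun z t ht => congrArg star (eq_inv_of_mul_eq_one_left ht)

theorem exists_norm_resolventI_sub_functionOf_le {ε : ℝ} (hε : 0 < ε) :
    ∃ f : ℝ → ℂ, Continuous f ∧ HasCompactSupport f ∧ ‖resolventI A - functionOf A f‖ ≤ ε := by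
  have hn := (isResolvent_resolventI hA).isStarNormal hA
  have hcont : Continuous fun t : ℝ => ((t : ℂ) + Complex.I)⁻¹ :=
    Continuous.inv₀ (by fun_prop) add_I_ne_zero
  -- A tent of height 1 and half-width 1/ε cuts off (t + i)⁻¹; the error is at most ε|t|/|t + i| ≤
  -- ε.
  have hf : Continuous fun t : ℝ => ((max 0 (1 - ε * |t|) : ℝ) : ℂ) * ((t : ℂ) + Complex.I)⁻¹ :=
    (Complex.continuous_ofReal.comp (by fun_prop)).mul hcont
  have hc : HasCompactSupport
      fun t : ℝ => ((max 0 (1 - ε * |t|) : ℝ) : ℂ) * ((t : ℂ) + Complex.I)⁻¹ := by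
    refine HasCompactSupport.intro (isCompact_closedBall (0 : ℝ) ε⁻¹) fun t ht => ?_
    rw [mem_closedBall_zero_iff, not_le, Real.norm_eq_abs, inv_lt_iff_one_lt_mul₀ hε] at ht
    rw [max_eq_left (by linarith), Complex.ofReal_zero, zero_mul]
  refine ⟨_, hf, hc, ?_⟩
  rw [functionOf_eq]
  nth_rw 1 [← cfc_id' ℂ (resolventI A)]
  rw [← cfc_sub (fun z : ℂ => z) _ (resolventI A) (by fun_prop)
    (continuousOn_resolventSymbol hA hf hc)]
  refine norm_cfc_le hε.le fun z hz => ?_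
  by_cases h0 : z = 0
  · simpa [resolventSymbol, h0] using hε.le
  obtain ⟨t, ht, hft⟩ := exists_real_of_mem_spectrum hA hz h0
  rw [hft, ← eq_inv_of_mul_eq_one_left ht]
  have e : z - ((max 0 (1 - ε * |t|) : ℝ) : ℂ) * z = ((1 - max 0 (1 - ε * |t|) : ℝ) : ℂ) * z := by
    push_cast; ring
  rw [e, norm_mul, Complex.norm_real, Real.norm_eq_abs]
  have h1 : |1 - max 0 (1 - ε * |t|)| ≤ ε * |t| := by
    have : 0 ≤ ε * |t| := by positivity
    rw [abs_le]
    constructor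
    · linarith [max_le (show (0 : ℝ) ≤ 1 by norm_num) (show 1 - ε * |t| ≤ 1 by linarith)]
    · linarith [le_max_right 0 (1 - ε * |t|)]
  have h2 : |t| * ‖z‖ ≤ 1 := by
    have h3 : ‖z‖ * ‖(t : ℂ) + Complex.I‖ = 1 := by rw [← norm_mul, ht, norm_one]
    have h4 : |t| ≤ ‖(t : ℂ) + Complex.I‖ := by
      simpa using Complex.abs_re_le_norm ((t : ℂ) + Complex.I)
    nlinarith [norm_nonneg z]
  calc _ ≤ ε * |t| * ‖z‖ := by gcongr
    _ = ε * (|t| * ‖z‖) := by ring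
    _ ≤ ε := mul_le_of_le_one_right hε.le h2

theorem IsReducing.functionOf {K : Submodule ℂ H} (h : IsReducing (resolventI A) K)
    (hK : IsClosed (K : Set H)) (f : ℝ → ℂ) : IsReducing (functionOf A f) K := by
  have hn := (isResolvent_resolventI hA).isStarNormal hA
  refine h.apply_mem_of_mem_elemental hK ?_
  rw [functionOf_eq]
  exact cfc_mem_elemental _ _

/-- The orbit of `S` is the smallest closed reducing subspace that contains `S`. -/
theorem orbit_le {K : Submodule ℂ H} (h : IsReducing (resolventI A) K)
    (hK : IsClosed (K : Set H)) {S : Set H} (hS : S ⊆ K) : orbit A S ≤ K := by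
  refine Submodule.topologicalClosure_minimal _ (Submodule.span_le.2 ?_) hK
  rintro _ ⟨f, -, -, w, hw, rfl⟩
  exact (h.functionOf hA hK f _ (hS hw)).1

/-- Not immediate, since the constant 1 has no compact support. The component u of w orthogonal to
the orbit satisfies f(A)u = 0 for every admissible f, because f(A)u lies both in the orbit and in
its complement. Norm approximation gives Ru = 0, and R is injective. -/
theorem subset_orbit (S : Set H) : S ⊆ orbit A S := by
  have hn := (isResolvent_resolventI hA).isStarNormal hA
  intro w hw
  have hcl : IsClosed (orbit A S : Set H) := Submodule.isClosed_topologicalClosure _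
  have : CompleteSpace (orbit A S) := hcl.completeSpace_coe
  set u := w - (orbit A S).starProjection w with hu
  have hzero : ∀ f : ℝ → ℂ, Continuous f → HasCompactSupport f → functionOf A f u = 0 := by
    intro f hf hc
    have hred := (isReducing_orbit hA S).functionOf hA hcl f
    refine Submodule.disjoint_def.1 (orbit A S).orthogonal_disjoint _ ?_
      (hred.orthogonal _ ((orbit A S).sub_starProjection_mem_orthogonal w)).1
    rw [hu, map_sub]
    exact Submodule.sub_mem _
      (Submodule.le_topologicalClosure _ (Submodule.subset_span ⟨f, hf, hc, w, hw, rfl⟩))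
      (hred _ ((orbit A S).starProjection_apply_mem w)).1
  have hRu : resolventI A u = 0 := by
    rw [← norm_le_zero_iff]
    refine le_of_forall_pos_le_add fun ε hε => ?_
    obtain ⟨f, hf, hc, hn⟩ := exists_norm_resolventI_sub_functionOf_le hA
      (show 0 < ε / (‖u‖ + 1) by positivity)
    have := (resolventI A - functionOf A f).le_of_opNorm_le hn u
    rw [sub_apply, hzero f hf hc, sub_zero] at this
    refine this.trans ?_
    rw [zero_add, div_mul_eq_mul_div, div_le_iff₀ (by positivity)]
    nlinarith [norm_nonneg u]
  have : u = 0 := (isResolvent_resolventI hA).injective (by rw [hRu, map_zero])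
  rw [sub_eq_zero] at this
  rw [this]
  exact (orbit A S).starProjection_apply_mem w

omit hA in
theorem isClosed_orbit (A : H →ₗ.[ℂ] H) (S : Set H) : IsClosed (orbit A S : Set H) :=
  Submodule.isClosed_topologicalClosure _

theorem isInvariant_iff {K : Submodule ℂ H} :
    IsInvariant A K ↔ IsClosed (K : Set H) ∧ IsReducing (resolventI A) K := by
  constructor
  · intro h
    have h' : orbit A K = K := h
    rw [← h']
    exact ⟨isClosed_orbit _ _, isReducing_orbit hA _⟩
  · rintro ⟨hK, h⟩
    exact le_antisymm (orbit_le hA h hK subset_rfl) (subset_orbit hA _)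

/-- A closed subspace is invariant if and only if its projection preserves the domain and commutes
with the operator there. -/
theorem isInvariant_iff_starProjection {K : Submodule ℂ H} [K.HasOrthogonalProjection]
    (hK : IsClosed (K : Set H)) : IsInvariant A K ↔ ∀ x : A.domain,
      ∃ h : K.starProjection x ∈ A.domain, A ⟨K.starProjection x, h⟩ = K.starProjection (A x) := by
  rw [isInvariant_iff hA, ← (isResolvent_resolventI hA).commute_iff, isReducing_iff_commute]
  exact and_iff_right hK

end SelfAdjoint
end Calculus

/-! ### Orthogonal decompositions and orbits -/

section Decomposition

variable {H : Type*} [NormedAddCommGroup H] [InnerProductSpace ℂ H] [CompleteSpace H]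

theorem hasOrthogonalProjection_of_isClosed {K : Submodule ℂ H} (hK : IsClosed (K : Set H)) :
    K.HasOrthogonalProjection :=
  have := hK.completeSpace_coe
  inferInstance

theorem IsOrthogonalDecomposition.eq_zero {κ : Type*} {K : κ → Submodule ℂ H}
    (h : IsOrthogonalDecomposition K) {x : H} (hx : ∀ α, x ∈ (K α)ᗮ) : x = 0 := by
  have h1 : (⨆ α, K α)ᗮ = ⊥ := Submodule.topologicalClosure_eq_top_iff.1 h.total
  rw [← Submodule.mem_bot ℂ, ← h1, ← Submodule.iInf_orthogonal, Submodule.mem_iInf]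
  exact hx

/-- The complement of an orbit is again reducing, so it contains the orbit of each of its subsets.
-/
theorem orbit_isOrtho {A : H →ₗ.[ℂ] H} (hA : IsSelfAdjoint A) {S T : Set H}
    (h : ∀ x ∈ S, x ∈ (orbit A T)ᗮ) : orbit A S ⟂ orbit A T :=
  orbit_le hA (isReducing_orbit hA T).orthogonal (Submodule.isClosed_orthogonal _) h

theorem isInvariant_orbit {A : H →ₗ.[ℂ] H} (hA : IsSelfAdjoint A) (S : Set H) :
    IsInvariant A (orbit A S) :=
  (isInvariant_iff hA).2 ⟨isClosed_orbit A S, isReducing_orbit hA S⟩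

theorem isInvariant_top {A : H →ₗ.[ℂ] H} (hA : IsSelfAdjoint A) :
    IsInvariant A (⊤ : Submodule ℂ H) :=
  (isInvariant_iff hA).2 ⟨isClosed_univ, isReducing_top _⟩

end Decomposition

/-! ### Invariant subspaces of the block operator -/

section System

variable {H₁ H₂ : Type*}
  [NormedAddCommGroup H₁] [InnerProductSpace ℂ H₁] [CompleteSpace H₁]
  [NormedAddCommGroup H₂] [InnerProductSpace ℂ H₂] [CompleteSpace H₂]

omit [CompleteSpace H₁] [CompleteSpace H₂] in
theorem isClosed_directSum {K₁ : Submodule ℂ H₁} {K₂ : Submodule ℂ H₂}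
    (h₁ : IsClosed (K₁ : Set H₁)) (h₂ : IsClosed (K₂ : Set H₂)) :
    IsClosed (directSum K₁ K₂ : Set (WithLp 2 (H₁ × H₂))) :=
  (h₁.preimage (WithLp.fstL 2 ℂ H₁ H₂).continuous).inter
    (h₂.preimage (WithLp.sndL 2 ℂ H₁ H₂).continuous)

omit [CompleteSpace H₁] [CompleteSpace H₂] in
theorem starProjection_directSum (K₁ : Submodule ℂ H₁) (K₂ : Submodule ℂ H₂)
    [K₁.HasOrthogonalProjection] [K₂.HasOrthogonalProjection]
    [(directSum K₁ K₂).HasOrthogonalProjection] (x : H₁) (y : H₂) :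
    (directSum K₁ K₂).starProjection (WithLp.toLp 2 (x, y)) =
      WithLp.toLp 2 (K₁.starProjection x, K₂.starProjection y) := by
  refine Submodule.eq_starProjection_of_mem_of_inner_eq_zero
    ⟨K₁.starProjection_apply_mem x, K₂.starProjection_apply_mem y⟩ fun w hw => ?_
  change ⟪x - K₁.starProjection x, w.fst⟫_ℂ + ⟪y - K₂.starProjection y, w.snd⟫_ℂ = 0
  rw [K₁.starProjection_inner_eq_zero _ _ hw.1, K₂.starProjection_inner_eq_zero _ _ hw.2, add_zero]

/-- Since Γ† maps K₁ into K₂, Γ maps the complement of K₂ into that of K₁. -/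
theorem apply_starProjection {K₁ : Submodule ℂ H₁} {K₂ : Submodule ℂ H₂}
    [K₁.HasOrthogonalProjection] [K₂.HasOrthogonalProjection] {Γ : H₂ →L[ℂ] H₁}
    (h : ∀ y ∈ K₂, Γ y ∈ K₁) (h' : ∀ x ∈ K₁, ContinuousLinearMap.adjoint Γ x ∈ K₂) (y : H₂) :
    Γ (K₂.starProjection y) = K₁.starProjection (Γ y) := by
  refine (Submodule.eq_starProjection_of_mem_of_inner_eq_zero
    (h _ (K₂.starProjection_apply_mem y)) fun w hw => ?_).symm
  rw [← map_sub, ← ContinuousLinearMap.adjoint_inner_right]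
  exact K₂.starProjection_inner_eq_zero _ _ (h' w hw)

theorem adjoint_apply_starProjection {K₁ : Submodule ℂ H₁} {K₂ : Submodule ℂ H₂}
    [K₁.HasOrthogonalProjection] [K₂.HasOrthogonalProjection] {Γ : H₂ →L[ℂ] H₁}
    (h : ∀ y ∈ K₂, Γ y ∈ K₁) (h' : ∀ x ∈ K₁, ContinuousLinearMap.adjoint Γ x ∈ K₂) (x : H₁) :
    ContinuousLinearMap.adjoint Γ (K₁.starProjection x) =
      K₂.starProjection (ContinuousLinearMap.adjoint Γ x) :=
  apply_starProjection h' (by rwa [ContinuousLinearMap.adjoint_adjoint]) x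

variable {Ω₁ : H₁ →ₗ.[ℂ] H₁} {Ω₂ : H₂ →ₗ.[ℂ] H₂} {Γ : H₂ →L[ℂ] H₁}

/-- `K₁ ⊕ K₂` is invariant under the frequency operator if and only if each `Kᵢ` is invariant
under `Ωᵢ` and `Γ`, `Γ†` map the subspaces to each other. -/
theorem isInvariant_directSum_iff (hΩ₁ : IsSelfAdjoint Ω₁) (hΩ₂ : IsSelfAdjoint Ω₂)
    {K₁ : Submodule ℂ H₁} {K₂ : Submodule ℂ H₂} (hK₁ : IsClosed (K₁ : Set H₁))
    (hK₂ : IsClosed (K₂ : Set H₂)) :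
    IsInvariant (frequencyOperator Ω₁ Ω₂ Γ) (directSum K₁ K₂) ↔
      IsInvariant Ω₁ K₁ ∧ IsInvariant Ω₂ K₂ ∧ (∀ y ∈ K₂, Γ y ∈ K₁) ∧
        ∀ x ∈ K₁, ContinuousLinearMap.adjoint Γ x ∈ K₂ := by
  have := hasOrthogonalProjection_of_isClosed hK₁
  have := hasOrthogonalProjection_of_isClosed hK₂
  have := hasOrthogonalProjection_of_isClosed (isClosed_directSum hK₁ hK₂)
  rw [isInvariant_iff_starProjection (isSelfAdjoint_frequencyOperator hΩ₁ hΩ₂ Γ)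
    (isClosed_directSum hK₁ hK₂), isInvariant_iff_starProjection hΩ₁ hK₁,
    isInvariant_iff_starProjection hΩ₂ hK₂]
  have key : (∀ x : (frequencyOperator Ω₁ Ω₂ Γ).domain,
      ∃ h : (directSum K₁ K₂).starProjection x ∈ (frequencyOperator Ω₁ Ω₂ Γ).domain,
        frequencyOperator Ω₁ Ω₂ Γ ⟨(directSum K₁ K₂).starProjection x, h⟩ =
          (directSum K₁ K₂).starProjection (frequencyOperator Ω₁ Ω₂ Γ x)) ↔
      ∀ (x : Ω₁.domain) (y : Ω₂.domain), ∃ (h₁ : K₁.starProjection x ∈ Ω₁.domain)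
        (h₂ : K₂.starProjection y ∈ Ω₂.domain),
        Ω₁ ⟨K₁.starProjection x, h₁⟩ + Γ (K₂.starProjection y) =
          K₁.starProjection (Ω₁ x + Γ y) ∧
        ContinuousLinearMap.adjoint Γ (K₁.starProjection x) + Ω₂ ⟨K₂.starProjection y, h₂⟩ =
          K₂.starProjection (ContinuousLinearMap.adjoint Γ x + Ω₂ y) := by
    constructor
    · intro h x y
      obtain ⟨hd, e⟩ := h ⟨WithLp.toLp 2 ((x : H₁), (y : H₂)), x.2, y.2⟩
      have hp := starProjection_directSum K₁ K₂ (x : H₁) (y : H₂)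
      have hd' : WithLp.toLp 2 (K₁.starProjection (x : H₁), K₂.starProjection (y : H₂)) ∈
          (frequencyOperator Ω₁ Ω₂ Γ).domain := hp ▸ hd
      rw [show (⟨_, hd⟩ : (frequencyOperator Ω₁ Ω₂ Γ).domain) = ⟨_, hd'⟩ from Subtype.ext hp] at e
      have e' := e.trans (starProjection_directSum K₁ K₂ (Ω₁ x + Γ y)
        (ContinuousLinearMap.adjoint Γ x + Ω₂ y))
      exact ⟨hd'.1, hd'.2, congrArg WithLp.fst e', congrArg WithLp.snd e'⟩
    · intro h x
      obtain ⟨h₁, h₂, e₁, e₂⟩ := h ⟨x.1.fst, x.2.1⟩ ⟨x.1.snd, x.2.2⟩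
      have hp : (directSum K₁ K₂).starProjection (x : WithLp 2 (H₁ × H₂)) = _ :=
        starProjection_directSum K₁ K₂ x.1.fst x.1.snd
      have hd' : WithLp.toLp 2 (K₁.starProjection x.1.fst, K₂.starProjection x.1.snd) ∈
          (frequencyOperator Ω₁ Ω₂ Γ).domain := ⟨h₁, h₂⟩
      have hd : (directSum K₁ K₂).starProjection (x : WithLp 2 (H₁ × H₂)) ∈
          (frequencyOperator Ω₁ Ω₂ Γ).domain := hp ▸ hd'
      refine ⟨hd, ?_⟩
      rw [show (⟨_, hd⟩ : (frequencyOperator Ω₁ Ω₂ Γ).domain) = ⟨_, hd'⟩ from Subtype.ext hp]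
      refine Eq.trans ?_ (starProjection_directSum K₁ K₂ _ _).symm
      exact congrArg (WithLp.toLp 2) (Prod.ext e₁ e₂)
  rw [key]
  constructor
  · intro h
    -- Setting y = 0 isolates the first column of the block matrix; `hy` does the same for the
    -- second with x = 0.
    have hx : ∀ x : Ω₁.domain, ∃ h₁ : K₁.starProjection x ∈ Ω₁.domain,
        Ω₁ ⟨K₁.starProjection x, h₁⟩ = K₁.starProjection (Ω₁ x) ∧
        ContinuousLinearMap.adjoint Γ (K₁.starProjection x) =
          K₂.starProjection (ContinuousLinearMap.adjoint Γ x) := by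
      intro x
      obtain ⟨h₁, h₂, e₁, e₂⟩ := h x 0
      rw [show (⟨_, h₂⟩ : Ω₂.domain) = 0 from Subtype.ext (map_zero _)] at e₂
      simp only [ZeroMemClass.coe_zero, map_zero, add_zero, LinearPMap.map_zero] at e₁ e₂
      exact ⟨h₁, e₁, e₂⟩
    have hy : ∀ y : Ω₂.domain, ∃ h₂ : K₂.starProjection y ∈ Ω₂.domain,
        Ω₂ ⟨K₂.starProjection y, h₂⟩ = K₂.starProjection (Ω₂ y) ∧
        Γ (K₂.starProjection y) = K₁.starProjection (Γ y) := by
      intro y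
      obtain ⟨h₁, h₂, e₁, e₂⟩ := h 0 y
      rw [show (⟨_, h₁⟩ : Ω₁.domain) = 0 from Subtype.ext (map_zero _)] at e₁
      simp only [ZeroMemClass.coe_zero, map_zero, zero_add, LinearPMap.map_zero] at e₁ e₂
      exact ⟨h₂, e₂, e₁⟩
    -- The relations for Γ and Γ† are known on the dense domains only; boundedness extends them.
    have c₁ : (fun x => ContinuousLinearMap.adjoint Γ (K₁.starProjection x)) =
        fun x => K₂.starProjection (ContinuousLinearMap.adjoint Γ x) :=
      Continuous.ext_on hΩ₁.dense_domain (by fun_prop) (by fun_prop)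
        fun x hxd => (hx ⟨x, hxd⟩).choose_spec.2
    have c₂ : (fun y => Γ (K₂.starProjection y)) = fun y => K₁.starProjection (Γ y) :=
      Continuous.ext_on hΩ₂.dense_domain (by fun_prop) (by fun_prop)
        fun y hyd => (hy ⟨y, hyd⟩).choose_spec.2
    refine ⟨fun x => ⟨(hx x).choose, (hx x).choose_spec.1⟩,
      fun y => ⟨(hy y).choose, (hy y).choose_spec.1⟩, fun y hyK => ?_, fun x hxK => ?_⟩
    · rw [← Submodule.starProjection_eq_self_iff.2 hyK, congrFun c₂ y]
      exact K₁.starProjection_apply_mem _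
    · rw [← Submodule.starProjection_eq_self_iff.2 hxK, congrFun c₁ x]
      exact K₂.starProjection_apply_mem _
  · rintro ⟨h₁, h₂, hΓ, hΓ'⟩ x y
    obtain ⟨d₁, e₁⟩ := h₁ x
    obtain ⟨d₂, e₂⟩ := h₂ y
    refine ⟨d₁, d₂, ?_, ?_⟩
    · rw [e₁, apply_starProjection hΓ hΓ', map_add]
    · rw [e₂, adjoint_apply_starProjection hΓ hΓ', map_add]

theorem IsSInvariantDecomposition.isInvariant (hΩ₁ : IsSelfAdjoint Ω₁) (hΩ₂ : IsSelfAdjoint Ω₂)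
    {κ : Type*} {K₁ : κ → Submodule ℂ H₁} {K₂ : κ → Submodule ℂ H₂}
    (h : IsSInvariantDecomposition Ω₁ Ω₂ Γ K₁ K₂) (α : κ) :
    IsInvariant Ω₁ (K₁ α) ∧ IsInvariant Ω₂ (K₂ α) ∧ (∀ y ∈ K₂ α, Γ y ∈ K₁ α) ∧
      ∀ x ∈ K₁ α, ContinuousLinearMap.adjoint Γ x ∈ K₂ α :=
  (isInvariant_directSum_iff hΩ₁ hΩ₂ (h.decomposition₁.closed α) (h.decomposition₂.closed α)).1
    (h.invariant α)

/-- The decomposition with one summand. -/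
theorem isSInvariantDecomposition_top (hΩ₁ : IsSelfAdjoint Ω₁) (hΩ₂ : IsSelfAdjoint Ω₂) :
    IsSInvariantDecomposition Ω₁ Ω₂ Γ (fun _ : Unit => (⊤ : Submodule ℂ H₁))
      (fun _ : Unit => (⊤ : Submodule ℂ H₂)) where
  decomposition₁ := ⟨fun _ => isClosed_univ, fun _ _ h => (h rfl).elim, by
    rw [iSup_const]; exact isClosed_univ.submodule_topologicalClosure_eq⟩
  decomposition₂ := ⟨fun _ => isClosed_univ, fun _ _ h => (h rfl).elim, by
    rw [iSup_const]; exact isClosed_univ.submodule_topologicalClosure_eq⟩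
  invariant _ := (isInvariant_directSum_iff hΩ₁ hΩ₂ isClosed_univ isClosed_univ).2
    ⟨isInvariant_top hΩ₁, isInvariant_top hΩ₂, fun _ _ => trivial, fun _ _ => trivial⟩

/-! ### Singular vectors and their orbits -/

namespace IsSingularDecomposition

variable {ι : Type*} {γ : ι → ℝ} {g : ι → H₁} {g' : ι → H₂}
  (hS : IsSingularDecomposition Γ γ g g')
include hS

omit [CompleteSpace H₁] [CompleteSpace H₂]

theorem sqrt_ne_zero (q : ι) : (Real.sqrt (γ q) : ℂ) ≠ 0 :=
  Complex.ofReal_ne_zero.2 (Real.sqrt_pos.2 (hS.pos q)).ne'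

theorem apply_right (q : ι) : Γ (g' q) = (Real.sqrt (γ q) : ℂ) • g q := by
  refine (hS.hasSum (g' q)).unique ?_
  convert hasSum_single (f := fun p => ((Real.sqrt (γ p) : ℂ) * ⟪g' p, g' q⟫_ℂ) • g p) q ?_ using 1
  · simp [inner_self_eq_norm_sq_to_K, hS.orthonormal_right.1 q]
  · intro p hp
    simp [hS.orthonormal_right.2 hp]

theorem inner_left (q : ι) (v : H₂) : ⟪g q, Γ v⟫_ℂ = (Real.sqrt (γ q) : ℂ) * ⟪g' q, v⟫_ℂ := by
  have h1 := (hS.hasSum v).mapL (innerSL ℂ (g q))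
  refine (h1.unique (hasSum_single q fun p hp => ?_)).trans ?_
  · rw [innerSL_apply_apply, inner_smul_right, hS.orthonormal_left.2 hp.symm, mul_zero]
  · rw [innerSL_apply_apply, inner_smul_right, inner_self_eq_norm_sq_to_K,
      hS.orthonormal_left.1 q]
    simp

theorem apply_eq_zero {v : H₂} (hv : ∀ q, ⟪g' q, v⟫_ℂ = 0) : Γ v = 0 := by
  refine (hS.hasSum v).unique ?_
  simp [hv, hasSum_zero]

theorem apply_mem {v : H₂} {K : Submodule ℂ H₁} (hK : IsClosed (K : Set H₁))
    (h : ∀ q, ⟪g' q, v⟫_ℂ ≠ 0 → g q ∈ K) : Γ v ∈ K := by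
  refine hK.mem_of_tendsto (hS.hasSum v) (Filter.Eventually.of_forall fun s => ?_)
  refine K.sum_mem fun q _ => ?_
  by_cases h0 : ⟪g' q, v⟫_ℂ = 0
  · simp [h0]
  · exact K.smul_mem _ (h q h0)

variable [CompleteSpace H₁] [CompleteSpace H₂]

theorem adjoint_apply_left (q : ι) :
    ContinuousLinearMap.adjoint Γ (g q) = (Real.sqrt (γ q) : ℂ) • g' q := by
  refine ext_inner_right ℂ fun v => ?_
  rw [ContinuousLinearMap.adjoint_inner_left, hS.inner_left, inner_smul_left, Complex.conj_ofReal]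

/-- Γ†g_q is a nonzero multiple of g'_q. Hence compatibility need only be demanded of the left
vectors. -/
theorem right_mem {K₁ : Submodule ℂ H₁} {K₂ : Submodule ℂ H₂}
    (h : ∀ x ∈ K₁, ContinuousLinearMap.adjoint Γ x ∈ K₂) {q : ι} (hq : g q ∈ K₁) : g' q ∈ K₂ := by
  have := h _ hq
  rw [hS.adjoint_apply_left] at this
  exact (K₂.smul_mem_iff (hS.sqrt_ne_zero q)).1 this

/-- In a reconstructible system the orbits of the coupling channels are everything. -/
theorem orbit_right_eq_top (hΩ₁ : IsSelfAdjoint Ω₁) (hΩ₂ : IsSelfAdjoint Ω₂)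
    (hr : IsReconstructible Ω₁ Ω₂ Γ) : orbit Ω₂ (Set.range g') = ⊤ := by
  have hcl := isClosed_orbit Ω₂ (Set.range g')
  -- Γ vanishes on the complement of the orbit of the g'_q, so Γ† maps into that orbit. The
  -- resulting invariant subspace contains H₁ ⊕ 0, hence is everything.
  have hinv : IsInvariant (frequencyOperator Ω₁ Ω₂ Γ)
      (directSum (⊤ : Submodule ℂ H₁) (orbit Ω₂ (Set.range g'))) := by
    refine (isInvariant_directSum_iff hΩ₁ hΩ₂ isClosed_univ hcl).2
      ⟨isInvariant_top hΩ₁, isInvariant_orbit hΩ₂ _, fun _ _ => trivial, fun x _ => ?_⟩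
    have := hasOrthogonalProjection_of_isClosed hcl
    rw [← Submodule.orthogonal_orthogonal (orbit Ω₂ (Set.range g'))]
    rw [Submodule.mem_orthogonal]
    intro v hv
    rw [ContinuousLinearMap.adjoint_inner_right, hS.apply_eq_zero, inner_zero_left]
    exact fun q => hv _ (subset_orbit hΩ₂ _ ⟨q, rfl⟩)
  have hsa := isSelfAdjoint_frequencyOperator hΩ₁ hΩ₂ Γ
  have hle := orbit_le hsa ((isInvariant_iff hsa).1 hinv).2 ((isInvariant_iff hsa).1 hinv).1
    (S := (directSum (⊤ : Submodule ℂ H₁) (⊥ : Submodule ℂ H₂) : Set (WithLp 2 (H₁ × H₂))))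
    (fun x hx => ⟨trivial, by rw [show x.snd = 0 from hx.2]; exact Submodule.zero_mem _⟩)
  rw [hr.from_first] at hle
  exact eq_top_iff.2 fun y _ => (hle (Submodule.mem_top (x := WithLp.toLp 2 ((0 : H₁), y)))).2

theorem orbit_left_eq_top (hΩ₁ : IsSelfAdjoint Ω₁) (hΩ₂ : IsSelfAdjoint Ω₂)
    (hr : IsReconstructible Ω₁ Ω₂ Γ) : orbit Ω₁ (Set.range g) = ⊤ := by
  have hcl := isClosed_orbit Ω₁ (Set.range g)
  have hinv : IsInvariant (frequencyOperator Ω₁ Ω₂ Γ)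
      (directSum (orbit Ω₁ (Set.range g)) (⊤ : Submodule ℂ H₂)) :=
    (isInvariant_directSum_iff hΩ₁ hΩ₂ hcl isClosed_univ).2
      ⟨isInvariant_orbit hΩ₁ _, isInvariant_top hΩ₂,
        fun y _ => hS.apply_mem hcl fun q _ => subset_orbit hΩ₁ _ ⟨q, rfl⟩, fun _ _ => trivial⟩
  have hsa := isSelfAdjoint_frequencyOperator hΩ₁ hΩ₂ Γ
  have hle := orbit_le hsa ((isInvariant_iff hsa).1 hinv).2 ((isInvariant_iff hsa).1 hinv).1
    (S := (directSum (⊥ : Submodule ℂ H₁) (⊤ : Submodule ℂ H₂) : Set (WithLp 2 (H₁ × H₂))))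
    (fun x hx => ⟨by rw [show x.fst = 0 from hx.1]; exact Submodule.zero_mem _, trivial⟩)
  rw [hr.from_second] at hle
  exact eq_top_iff.2 fun y _ => (hle (Submodule.mem_top (x := WithLp.toLp 2 (y, (0 : H₂))))).1

end IsSingularDecomposition

/-- No edge joins two components, so orthogonality of generators to single orbits spreads, by two
uses of `orbit_isOrtho`, to the whole component orbits. -/
theorem isOrthogonalDecomposition_componentOrbit {H : Type*} [NormedAddCommGroup H]
    [InnerProductSpace ℂ H] [CompleteSpace H] {A : H →ₗ.[ℂ] H} (hA : IsSelfAdjoint A)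
    {ι : Type*} {g : ι → H} {G : SimpleGraph ι} (htop : orbit A (Set.range g) = ⊤)
    (hG : ∀ p q, p ≠ q → ¬ G.Adj p q → g q ∈ (orbit A {g p})ᗮ) :
    IsOrthogonalDecomposition (componentOrbit A g G) where
  closed _ := isClosed_orbit _ _
  ortho c c' hne := by
    refine orbit_isOrtho hA ?_
    rintro _ ⟨p, hp, rfl⟩
    rw [SimpleGraph.ConnectedComponent.mem_supp_iff] at hp
    have h1 : orbit A (g '' c'.supp) ⟂ orbit A {g p} := by
      refine orbit_isOrtho hA ?_
      rintro _ ⟨q, hq, rfl⟩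
      rw [SimpleGraph.ConnectedComponent.mem_supp_iff] at hq
      refine hG p q (fun h => hne ?_) (fun h => hne ?_)
      · rw [← hp, ← hq, h]
      · rw [← hp, ← hq]
        exact SimpleGraph.ConnectedComponent.sound h.reachable
    exact h1.symm (subset_orbit hA _ rfl)
  total := by
    rw [eq_top_iff, ← htop]
    refine orbit_le hA (IsReducing.iSup fun c => isReducing_orbit hA _).topologicalClosure
      (Submodule.isClosed_topologicalClosure _) ?_
    rintro _ ⟨q, rfl⟩
    exact Submodule.le_topologicalClosure _
      (Submodule.mem_iSup_of_mem (G.connectedComponentMk q) (subset_orbit hA _ ⟨q, rfl, rfl⟩))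

/-! ### The channel graph and finest decompositions -/

section Channels

variable {ι : Type*} {γ : ι → ℝ} {g : ι → H₁} {g' : ι → H₂}

theorem mem_orthogonal_of_not_adj {p q : ι} (hne : p ≠ q)
    (h : ¬ (channelGraph Ω₁ Ω₂ g g').Adj p q) :
    g q ∈ (orbit Ω₁ {g p})ᗮ ∧ g' q ∈ (orbit Ω₂ {g' p})ᗮ := by
  rw [channelGraph, SimpleGraph.fromRel_adj] at h
  by_contra hc
  exact h ⟨hne, Or.inl (not_and_or.1 hc)⟩

theorem isSInvariantDecomposition_componentOrbit (hΩ₁ : IsSelfAdjoint Ω₁)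
    (hΩ₂ : IsSelfAdjoint Ω₂) (hr : IsReconstructible Ω₁ Ω₂ Γ)
    (hS : IsSingularDecomposition Γ γ g g') :
    IsSInvariantDecomposition Ω₁ Ω₂ Γ (componentOrbit Ω₁ g (channelGraph Ω₁ Ω₂ g g'))
      (componentOrbit Ω₂ g' (channelGraph Ω₁ Ω₂ g g')) := by
  have d₁ := isOrthogonalDecomposition_componentOrbit hΩ₁ (hS.orbit_left_eq_top hΩ₁ hΩ₂ hr)
    fun p q hne h => (mem_orthogonal_of_not_adj (Ω₂ := Ω₂) (g' := g') hne h).1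
  have d₂ := isOrthogonalDecomposition_componentOrbit hΩ₂ (hS.orbit_right_eq_top hΩ₁ hΩ₂ hr)
    fun p q hne h => (mem_orthogonal_of_not_adj (Ω₁ := Ω₁) (g := g) hne h).2
  -- For y in the orbit of c, only channels q in c have ⟪g'_q, y⟫ ≠ 0, so only their g_q enter Γ y.
  have hm : ∀ c, ∀ y ∈ componentOrbit Ω₂ g' (channelGraph Ω₁ Ω₂ g g') c,
      Γ y ∈ componentOrbit Ω₁ g (channelGraph Ω₁ Ω₂ g g') c := by
    intro c y hy
    refine hS.apply_mem (isClosed_orbit _ _) fun q hq => subset_orbit hΩ₁ _ ⟨q, ?_, rfl⟩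
    by_contra hc
    refine hq (Submodule.isOrtho_iff_inner_eq.1 (d₂.ortho
      ((channelGraph Ω₁ Ω₂ g g').connectedComponentMk q) c hc) _ ?_ _ hy)
    exact subset_orbit hΩ₂ _ ⟨q, rfl, rfl⟩
  refine ⟨d₁, d₂, fun c => (isInvariant_directSum_iff hΩ₁ hΩ₂ (d₁.closed c) (d₂.closed c)).2
    ⟨isInvariant_orbit hΩ₁ _, isInvariant_orbit hΩ₂ _, hm c, fun x hx => ?_⟩⟩
  -- By duality with `hm`, Γ†x is orthogonal to the summands other than c, so it equals its
  -- projection onto summand c.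
  have := hasOrthogonalProjection_of_isClosed (d₂.closed c)
  rw [← Submodule.starProjection_eq_self_iff, eq_comm, ← sub_eq_zero]
  refine d₂.eq_zero fun c' => ?_
  by_cases hc : c = c'
  · exact hc ▸ Submodule.sub_starProjection_mem_orthogonal _
  · refine Submodule.sub_mem _ ?_ (d₂.ortho _ _ hc (Submodule.starProjection_apply_mem _ _))
    rw [Submodule.mem_orthogonal]
    intro y hy
    rw [ContinuousLinearMap.adjoint_inner_right]
    exact Submodule.isOrtho_iff_inner_eq.1 (d₁.ortho _ _ (Ne.symm hc)) _ (hm c' y hy) _ hx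

/-- The channel graph gives the finest decomposition compatible with the channels. -/
theorem exists_componentOrbit_le (hΩ₁ : IsSelfAdjoint Ω₁) (hΩ₂ : IsSelfAdjoint Ω₂)
    (hS : IsSingularDecomposition Γ γ g g') {κ : Type*} {L₁ : κ → Submodule ℂ H₁}
    {L₂ : κ → Submodule ℂ H₂} (hL : IsSInvariantDecomposition Ω₁ Ω₂ Γ L₁ L₂)
    (hg : ∀ q, ∃ β, g q ∈ L₁ β) (c : (channelGraph Ω₁ Ω₂ g g').ConnectedComponent) :
    ∃ β, componentOrbit Ω₁ g (channelGraph Ω₁ Ω₂ g g') c ≤ L₁ β ∧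
      componentOrbit Ω₂ g' (channelGraph Ω₁ Ω₂ g g') c ≤ L₂ β := by
  choose b hb using hg
  have hinv := hL.isInvariant hΩ₁ hΩ₂
  have hb' : ∀ q, g' q ∈ L₂ (b q) := fun q => hS.right_mem (hinv (b q)).2.2.2 (hb q)
  have le₁ : ∀ (S : Set H₁) (β : κ), S ⊆ L₁ β → orbit Ω₁ S ≤ L₁ β := fun S β h =>
    orbit_le hΩ₁ ((isInvariant_iff hΩ₁).1 (hinv β).1).2 (hL.decomposition₁.closed β) h
  have le₂ : ∀ (S : Set H₂) (β : κ), S ⊆ L₂ β → orbit Ω₂ S ≤ L₂ β := fun S β h =>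
    orbit_le hΩ₂ ((isInvariant_iff hΩ₂).1 (hinv β).2.1).2 (hL.decomposition₂.closed β) h
  -- The orbit of g_p stays in the summand of g_p, so it is orthogonal to all others: a nonzero
  -- overlap puts q in the same summand. Thus `b` is constant on components.
  have hrel : ∀ p q, (g q ∉ (orbit Ω₁ {g p})ᗮ ∨ g' q ∉ (orbit Ω₂ {g' p})ᗮ) → b p = b q := by
    intro p q h
    by_contra hne
    rcases h with h | h
    · exact h (((hL.decomposition₁.ortho _ _ hne).mono_left
        (le₁ {g p} _ (Set.singleton_subset_iff.2 (hb p)))).symm (hb q))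
    · exact h (((hL.decomposition₂.ortho _ _ hne).mono_left
        (le₂ {g' p} _ (Set.singleton_subset_iff.2 (hb' p)))).symm (hb' q))
  have hadj : ∀ p q, (channelGraph Ω₁ Ω₂ g g').Adj p q → b p = b q := by
    intro p q h
    rw [channelGraph, SimpleGraph.fromRel_adj] at h
    exact h.2.elim (hrel p q) fun h' => (hrel q p h').symm
  have hreach : ∀ p q, (channelGraph Ω₁ Ω₂ g g').Reachable p q → b p = b q := by
    rintro p q ⟨w⟩
    induction w with
    | nil => rfl
    | cons h _ ih => exact (hadj _ _ h).trans ih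
  obtain ⟨p, rfl⟩ := c.exists_rep
  refine ⟨b p, le₁ _ _ ?_, le₂ _ _ ?_⟩
  · rintro _ ⟨q, hq, rfl⟩
    rw [hreach p q (SimpleGraph.ConnectedComponent.exact hq).symm]
    exact hb q
  · rintro _ ⟨q, hq, rfl⟩
    rw [hreach p q (SimpleGraph.ConnectedComponent.exact hq).symm]
    exact hb' q

/-- A simple nonzero eigenvector of `Γ Γ†` lies in a summand of every s-invariant
decomposition. -/
theorem IsSInvariantDecomposition.exists_mem_of_finrank_eq_one (hΩ₁ : IsSelfAdjoint Ω₁)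
    (hΩ₂ : IsSelfAdjoint Ω₂) {κ : Type*} {K₁ : κ → Submodule ℂ H₁} {K₂ : κ → Submodule ℂ H₂}
    (h : IsSInvariantDecomposition Ω₁ Ω₂ Γ K₁ K₂) {μ : ℂ}
    (hμ : Module.finrank ℂ (Module.End.eigenspace
      ((Γ ∘L ContinuousLinearMap.adjoint Γ : H₁ →L[ℂ] H₁) : Module.End ℂ H₁) μ) = 1)
    {x : H₁} (hx0 : x ≠ 0) (hx : Γ (ContinuousLinearMap.adjoint Γ x) = μ • x) :
    ∃ α, x ∈ K₁ α := by
  by_contra! hc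
  refine hx0 (h.decomposition₁.eq_zero fun α => ?_)
  have := hasOrthogonalProjection_of_isClosed (h.decomposition₁.closed α)
  have := hasOrthogonalProjection_of_isClosed (h.decomposition₂.closed α)
  obtain ⟨-, -, h₁, h₂⟩ := h.isInvariant hΩ₁ hΩ₂ α
  by_contra hne
  have hne' : (K₁ α).starProjection x ≠ 0 := fun h0 =>
    hne ((Submodule.starProjection_apply_eq_zero_iff _).1 h0)
  have hP : (K₁ α).starProjection x ∈ Module.End.eigenspace
      ((Γ ∘L ContinuousLinearMap.adjoint Γ : H₁ →L[ℂ] H₁) : Module.End ℂ H₁) μ := by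
    rw [Module.End.mem_eigenspace_iff]
    change Γ (ContinuousLinearMap.adjoint Γ ((K₁ α).starProjection x)) = _
    rw [adjoint_apply_starProjection h₁ h₂, apply_starProjection h₁ h₂, hx, map_smul]
  have hX : x ∈ Module.End.eigenspace
      ((Γ ∘L ContinuousLinearMap.adjoint Γ : H₁ →L[ℂ] H₁) : Module.End ℂ H₁) μ :=
    Module.End.mem_eigenspace_iff.2 hx
  -- The projection of x onto K₁ α is a nonzero vector of the same line of eigenvectors, so x is a
  -- multiple of it.
  obtain ⟨a, ha⟩ := (finrank_eq_one_iff_of_nonzero' ⟨_, hP⟩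
    fun h0 => hne' (congrArg Subtype.val h0)).1 hμ ⟨x, hX⟩
  refine hc α ?_
  rw [show x = a • (K₁ α).starProjection x from (congrArg Subtype.val ha).symm]
  exact (K₁ α).smul_mem _ ((K₁ α).starProjection_apply_mem x)

end Channels

/-- Refining back and forth gives p ≤ q ≤ r with p, r in `D`. If p ≠ r, then p would be orthogonal
to itself, against `nonzero`; so p = q = r. -/
theorem IsFinestDecomposition.subset {D D' : Set (Submodule ℂ H₁ × Submodule ℂ H₂)}
    (h : IsFinestDecomposition Ω₁ Ω₂ Γ D) (h' : IsFinestDecomposition Ω₁ Ω₂ Γ D') : D ⊆ D' := by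
  intro p hp
  obtain ⟨q, hq, hpq⟩ := h.finest D' h'.sInvariant p hp
  obtain ⟨r, hrD, hqr⟩ := h'.finest D h.sInvariant q hq
  have hpr : p = r := by
    by_contra hne
    have hne' : (⟨p, hp⟩ : D) ≠ ⟨r, hrD⟩ := fun e => hne (congrArg Subtype.val e)
    have o₁ := h.sInvariant.decomposition₁.ortho _ _ hne'
    have o₂ := h.sInvariant.decomposition₂.ortho _ _ hne'
    refine h.nonzero p hp (Prod.ext ?_ ?_)
    · exact Submodule.isOrtho_self.1 (o₁.mono_right (hpq.1.trans hqr.1))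
    · exact Submodule.isOrtho_self.1 (o₂.mono_right (hpq.2.trans hqr.2))
  subst hpr
  rwa [show p = q from Prod.ext (le_antisymm hpq.1 hqr.1) (le_antisymm hpq.2 hqr.2)]

/-- With simple nonzero singular values, the decomposition given by the channel graph is the
unique finest s-invariant decomposition. -/
theorem existsUnique_isFinestDecomposition (hΩ₁ : IsSelfAdjoint Ω₁) (hΩ₂ : IsSelfAdjoint Ω₂)
    (hr : IsReconstructible Ω₁ Ω₂ Γ)
    (hsimple : ∀ μ : ℂ, μ ≠ 0 →
      Module.End.HasEigenvalue
        ((Γ ∘L ContinuousLinearMap.adjoint Γ : H₁ →L[ℂ] H₁) : Module.End ℂ H₁) μ →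
      Module.finrank ℂ (Module.End.eigenspace
        ((Γ ∘L ContinuousLinearMap.adjoint Γ : H₁ →L[ℂ] H₁) : Module.End ℂ H₁) μ) = 1)
    {ι : Type*} {γ : ι → ℝ} {g : ι → H₁} {g' : ι → H₂} (hS : IsSingularDecomposition Γ γ g g') :
    ∃! D : Set (Submodule ℂ H₁ × Submodule ℂ H₂), IsFinestDecomposition Ω₁ Ω₂ Γ D := by
  have hdec := isSInvariantDecomposition_componentOrbit hΩ₁ hΩ₂ hr hS
  set K₁ := componentOrbit Ω₁ g (channelGraph Ω₁ Ω₂ g g') with hK₁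
  set K₂ := componentOrbit Ω₂ g' (channelGraph Ω₁ Ω₂ g g') with hK₂
  have hfine : IsFinestDecomposition Ω₁ Ω₂ Γ (Set.range fun c => (K₁ c, K₂ c)) := by
    refine ⟨⟨⟨?_, ?_, ?_⟩, ⟨?_, ?_, ?_⟩, ?_⟩, ?_, ?_⟩
    · rintro ⟨_, c, rfl⟩
      exact hdec.decomposition₁.closed c
    · rintro ⟨_, c, rfl⟩ ⟨_, c', rfl⟩ hne
      exact hdec.decomposition₁.ortho c c' fun h => hne (by rw [h])
    · rw [eq_top_iff, ← hdec.decomposition₁.total]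
      exact Submodule.topologicalClosure_mono (iSup_le fun c => le_iSup
        (fun p : Set.range fun c => (K₁ c, K₂ c) => p.1.1) ⟨_, c, rfl⟩)
    · rintro ⟨_, c, rfl⟩
      exact hdec.decomposition₂.closed c
    · rintro ⟨_, c, rfl⟩ ⟨_, c', rfl⟩ hne
      exact hdec.decomposition₂.ortho c c' fun h => hne (by rw [h])
    · rw [eq_top_iff, ← hdec.decomposition₂.total]
      exact Submodule.topologicalClosure_mono (iSup_le fun c => le_iSup
        (fun p : Set.range fun c => (K₁ c, K₂ c) => p.1.2) ⟨_, c, rfl⟩)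
    · rintro ⟨_, c, rfl⟩
      exact hdec.invariant c
    · rintro _ ⟨c, rfl⟩ h
      obtain ⟨q, rfl⟩ := c.exists_rep
      have : g q ∈ K₁ _ := subset_orbit hΩ₁ _ ⟨q, rfl, rfl⟩
      rw [show K₁ ((channelGraph Ω₁ Ω₂ g g').connectedComponentMk q) = ⊥ from
        congrArg Prod.fst h, Submodule.mem_bot] at this
      exact hS.orthonormal_left.ne_zero q this
    · rintro E hE _ ⟨c, rfl⟩
      obtain ⟨⟨q, hq⟩, h⟩ := exists_componentOrbit_le hΩ₁ hΩ₂ hS hE (fun q => by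
        have e : Γ (ContinuousLinearMap.adjoint Γ (g q)) =
            ((Real.sqrt (γ q) : ℂ) * Real.sqrt (γ q)) • g q := by
          rw [hS.adjoint_apply_left, map_smul, hS.apply_right, smul_smul]
        have h0 := hS.orthonormal_left.ne_zero q
        exact hE.exists_mem_of_finrank_eq_one hΩ₁ hΩ₂ (hsimple _
          (mul_ne_zero (hS.sqrt_ne_zero q) (hS.sqrt_ne_zero q))
          (Module.End.hasEigenvalue_of_hasEigenvector
            ⟨Module.End.mem_eigenspace_iff.2 e, h0⟩)) h0 e) c
      exact ⟨q, hq, h⟩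
  exact ⟨_, hfine, fun D hD => (hD.subset hfine).antisymm (hfine.subset hD)⟩

end System

/-! ### Eigenvectors of Γ₀ and adapted singular vectors -/

section Representation

theorem countable_of_orthonormal {H : Type*} [NormedAddCommGroup H] [InnerProductSpace ℂ H]
    [TopologicalSpace.SeparableSpace H] {ι : Type*} {v : ι → H} (hv : Orthonormal ℂ v) :
    Countable ι := by
  refine Pairwise.countable_of_isOpen_disjoint (s := fun i => Metric.ball (v i) (1 / 2))
    (fun i j hij => Metric.ball_disjoint_ball ?_) (fun i => Metric.isOpen_ball)
    (fun i => ⟨v i, Metric.mem_ball_self (by norm_num)⟩)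
  have h : ‖v i - v j‖ ^ 2 = 2 := by
    rw [norm_sub_sq (𝕜 := ℂ), hv.2 hij, hv.1 i, hv.1 j]
    norm_num
  rw [dist_eq_norm]
  nlinarith [norm_nonneg (v i - v j)]

/-- An orthogonal family of closed subspaces with trivial common orthogonal complement in a
separable Hilbert space has a subordinate orthonormal basis. -/
theorem exists_orthonormal_subordinate {H : Type*} [NormedAddCommGroup H] [InnerProductSpace ℂ H]
    [CompleteSpace H] [TopologicalSpace.SeparableSpace H] {I : Type*} {M : I → Submodule ℂ H}
    (hcl : ∀ i, IsClosed (M i : Set H)) (hortho : ∀ i j, i ≠ j → M i ⟂ M j)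
    (htot : ∀ x, (∀ i, x ∈ (M i)ᗮ) → x = 0) :
    ∃ (ι : Type) (_ : Countable ι) (v : ι → H), Orthonormal ℂ v ∧
      (Submodule.span ℂ (Set.range v))ᗮ = ⊥ ∧ ∀ q, ∃ i, v q ∈ M i := by
  have : ∀ i, CompleteSpace (M i) := fun i => (hcl i).completeSpace_coe
  choose w b hb using fun i => exists_hilbertBasis ℂ (M i)
  have hfam : OrthogonalFamily ℂ (fun i => M i) fun i => (M i).subtypeₗᵢ := fun i j hij x y =>
    Submodule.isOrtho_iff_inner_eq.1 (hortho i j hij) _ x.2 _ y.2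
  have hv : Orthonormal ℂ fun a : Σ i, w i => ((b a.1 a.2 : M a.1) : H) :=
    hfam.orthonormal_sigma_orthonormal fun i => (b i).orthonormal
  have hc := countable_of_orthonormal hv
  obtain ⟨f, hf⟩ := exists_injective_nat (Σ i, w i)
  -- Reindexing by a set of naturals puts the index type in `Type`, whatever the universe of the
  -- family.
  let e := Equiv.ofInjective f hf
  refine ⟨Set.range f, inferInstance, _, hv.comp e.symm e.symm.injective, ?_,
    fun q => ⟨(e.symm q).1, ((b (e.symm q).1 (e.symm q).2 : M _)).2⟩⟩
  rw [e.symm.surjective.range_comp, Submodule.eq_bot_iff]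
  refine fun x hx => htot x fun i => ?_
  rw [← Submodule.starProjection_apply_eq_zero_iff]
  have hz : (b i).repr ((M i).orthogonalProjectionOnto x) = 0 := by
    ext k
    rw [(b i).repr_apply_apply, Submodule.coe_inner]
    have h1 := hx _ (Submodule.subset_span ⟨⟨i, k⟩, rfl⟩)
    have h2 := (M i).sub_starProjection_mem_orthogonal x _ (b i k).2
    rw [inner_sub_right, h1, zero_sub, neg_eq_zero] at h2
    exact h2
  rw [Submodule.starProjection_apply, (b i).repr.map_eq_zero_iff.1 hz]
  rfl

variable {H₁ H₂ H₀ : Type*}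
  [NormedAddCommGroup H₁] [InnerProductSpace ℂ H₁] [CompleteSpace H₁]
  [NormedAddCommGroup H₂] [InnerProductSpace ℂ H₂] [CompleteSpace H₂]
  [NormedAddCommGroup H₀] [InnerProductSpace ℂ H₀] [CompleteSpace H₀]
  {Γ : H₂ →L[ℂ] H₁} {U₁ : H₀ →ₗᵢ[ℂ] H₁} {U₂ : H₀ →ₗᵢ[ℂ] H₂} {Γ₀ : H₀ →L[ℂ] H₀}

/-- With S = √T, (S + a)(S - a)v = 0, so w = (S - a)v satisfies Sw = -aw; positivity of S and a > 0
force w = 0. -/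
theorem sqrt_apply_of_eigenvector {T : H₁ →L[ℂ] H₁} (hT : 0 ≤ T) {v : H₁} {a : ℝ} (ha : 0 < a)
    (hv : T v = ((a : ℂ) * a) • v) : CFC.sqrt T v = (a : ℂ) • v := by
  have hS := (ContinuousLinearMap.nonneg_iff_isPositive _).1 (CFC.sqrt_nonneg T)
  have hSS : CFC.sqrt T (CFC.sqrt T v) = T v :=
    congrArg (fun B : H₁ →L[ℂ] H₁ => B v) (CFC.sqrt_mul_sqrt_self T hT)
  set w := CFC.sqrt T v - (a : ℂ) • v with hw
  have h1 : CFC.sqrt T w = -(a : ℂ) • w := by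
    rw [hw, map_sub, map_smul, hSS, hv]
    module
  have h2 := hS.re_inner_nonneg_left w
  rw [h1, inner_smul_left, inner_self_eq_norm_sq_to_K] at h2
  have h3 : 0 ≤ -(a * ‖w‖ ^ 2) := by
    have e : conj (-(a : ℂ)) * ((‖w‖ : ℂ)) ^ 2 = ((-(a * ‖w‖ ^ 2) : ℝ) : ℂ) := by
      rw [map_neg, Complex.conj_ofReal]; push_cast; ring
    have h4 : 0 ≤ (conj (-(a : ℂ)) * ((‖w‖ : ℂ)) ^ 2).re := h2
    rwa [e, Complex.ofReal_re] at h4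
  have h5 : ‖w‖ ^ 2 ≤ 0 := by nlinarith [sq_nonneg ‖w‖]
  have h6 : w = 0 := by
    rw [← norm_eq_zero]
    exact pow_eq_zero_iff two_ne_zero |>.1 (le_antisymm h5 (sq_nonneg _))
  exact sub_eq_zero.1 h6

namespace IsStandardRepresentation

variable (h : IsStandardRepresentation Γ U₁ U₂ Γ₀)
include h

theorem inner_symm (x y : H₀) : ⟪Γ₀ x, y⟫_ℂ = ⟪x, Γ₀ y⟫_ℂ := by
  rw [← U₂.inner_map_map, h.eq₂, ContinuousLinearMap.adjoint_inner_left, ← h.eq₁, U₁.inner_map_map]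

theorem eq_zero_of_apply {x : H₀} (hx : Γ₀ x = 0) : x = 0 := by
  have h1 : ContinuousLinearMap.adjoint Γ (U₁ x) = 0 := by rw [← h.eq₂, hx, map_zero]
  have h2 : U₁ x ∈ (LinearMap.range (Γ : H₂ →ₗ[ℂ] H₁)).topologicalClosure := by
    rw [← h.range₁]; exact ⟨x, rfl⟩
  have h3 : U₁ x ∈ (LinearMap.range (Γ : H₂ →ₗ[ℂ] H₁)).topologicalClosureᗮ := by
    rw [Submodule.orthogonal_closure, Submodule.mem_orthogonal]
    rintro _ ⟨y, rfl⟩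
    change ⟪Γ y, U₁ x⟫_ℂ = 0
    rw [← ContinuousLinearMap.adjoint_inner_right, h1, inner_zero_right]
  have h4 : U₁ x = 0 := Submodule.disjoint_def.1 (Submodule.orthogonal_disjoint _) _ h2 h3
  exact U₁.injective (by rw [h4, map_zero])

/-- Symmetry makes the eigenvalue m real, injectivity makes it nonzero, and the polar decomposition
fixes its sign: √(ΓΓ†) multiplies U₁x by |m|, so `polar` yields U₂x = |m|⁻¹ m U₂x. -/
theorem eigenvalue_pos {x : H₀} (hx0 : x ≠ 0) {μ : ℂ} (hx : Γ₀ x = μ • x) :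
    ∃ s : ℝ, 0 < s ∧ μ = s := by
  have hre : conj μ = μ := by
    have := h.inner_symm x x
    rw [hx, inner_smul_left, inner_smul_right] at this
    exact mul_right_cancel₀ (inner_self_ne_zero.2 hx0) this
  obtain ⟨m, rfl⟩ := Complex.conj_eq_iff_real.1 hre
  have hm : m ≠ 0 := by
    rintro rfl
    exact hx0 (h.eq_zero_of_apply (by simpa using hx))
  have hT : (0 : H₁ →L[ℂ] H₁) ≤ Γ ∘L ContinuousLinearMap.adjoint Γ :=
    (ContinuousLinearMap.nonneg_iff_isPositive _).2
      (ContinuousLinearMap.isPositive_self_comp_adjoint Γ)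
  have habs : ((|m| : ℝ) : ℂ) * (|m| : ℝ) = (m : ℂ) * m := by
    rw [← Complex.ofReal_mul, abs_mul_abs_self, Complex.ofReal_mul]
  have hv : (Γ ∘L ContinuousLinearMap.adjoint Γ) (U₁ x) =
      (((|m| : ℝ) : ℂ) * (|m| : ℝ)) • U₁ x := by
    rw [habs, ContinuousLinearMap.comp_apply, ← h.eq₂, hx, map_smul, map_smul, ← h.eq₁, hx,
      map_smul, smul_smul]
  have ha : ((|m| : ℝ) : ℂ) ≠ 0 := Complex.ofReal_ne_zero.2 (abs_ne_zero.2 hm)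
  have hs := sqrt_apply_of_eigenvector hT (abs_pos.2 hm) hv
  have hp := h.polar x (((|m| : ℝ) : ℂ)⁻¹ • U₁ x) (by
    rw [map_smul, hs, smul_smul, inv_mul_cancel₀ ha, one_smul])
  rw [map_smul, ← h.eq₂, hx, map_smul, smul_smul] at hp
  have hU : U₂ x ≠ 0 := fun h0 => hx0 (U₂.injective (by rw [h0, map_zero]))
  have h1 : ((|m| : ℝ) : ℂ)⁻¹ * m = 1 := by
    have : (1 - ((|m| : ℝ) : ℂ)⁻¹ * m) • U₂ x = 0 := by
      rw [sub_smul, one_smul, ← hp, sub_self]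
    exact (sub_eq_zero.1 ((smul_eq_zero.1 this).resolve_right hU)).symm
  have h2 : (m : ℂ) = ((|m| : ℝ) : ℂ) := by
    field_simp at h1
    exact h1
  exact ⟨|m|, abs_pos.2 hm, h2⟩

/-- The component of an eigenvector of `Γ₀` in a summand of an s-invariant decomposition is an
eigenvector. -/
theorem exists_component {K₁ : Submodule ℂ H₁} {K₂ : Submodule ℂ H₂}
    [K₁.HasOrthogonalProjection] [K₂.HasOrthogonalProjection]
    (h₁ : ∀ y ∈ K₂, Γ y ∈ K₁) (h₂ : ∀ x ∈ K₁, ContinuousLinearMap.adjoint Γ x ∈ K₂)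
    {x : H₀} {μ : ℂ} (hx : Γ₀ x = μ • x) :
    ∃ x', U₁ x' = K₁.starProjection (U₁ x) ∧ Γ₀ x' = μ • x' := by
  by_cases hx0 : x = 0
  · exact ⟨0, by simp [hx0]⟩
  obtain ⟨s, hs, rfl⟩ := h.eigenvalue_pos hx0 hx
  -- The projection commutes with Γ through K₂, so it preserves the closure of Ran Γ, which is the
  -- range of U₁.
  have hmem : K₁.starProjection (U₁ x) ∈
      (LinearMap.range (Γ : H₂ →ₗ[ℂ] H₁)).topologicalClosure := by
    have hU : U₁ x ∈ (LinearMap.range (Γ : H₂ →ₗ[ℂ] H₁)).topologicalClosure := by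
      rw [← h.range₁]; exact ⟨x, rfl⟩
    refine map_mem_closure K₁.starProjection.continuous hU ?_
    rintro _ ⟨z, rfl⟩
    exact ⟨K₂.starProjection z, apply_starProjection h₁ h₂ z⟩
  rw [← h.range₁] at hmem
  obtain ⟨x', hx'⟩ := hmem
  replace hx' : U₁ x' = K₁.starProjection (U₁ x) := hx'
  refine ⟨x', hx', ?_⟩
  -- Commutation with ΓΓ† controls only the square of Γ₀. If Γ₀x' ≠ s x', their difference would be
  -- an eigenvector for -s, which positivity forbids.
  have hsq : Γ₀ (Γ₀ x') = ((s : ℂ) * s) • x' := by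
    apply U₁.injective
    rw [h.eq₁, h.eq₂, hx', adjoint_apply_starProjection h₁ h₂, apply_starProjection h₁ h₂,
      ← h.eq₂, ← h.eq₁, hx, map_smul, hx, map_smul, map_smul, map_smul, map_smul, map_smul,
      hx', smul_smul]
  by_contra hne
  have hy : Γ₀ (Γ₀ x' - (s : ℂ) • x') = ((-s : ℝ) : ℂ) • (Γ₀ x' - (s : ℂ) • x') := by
    rw [map_sub, map_smul, hsq]
    push_cast
    module
  obtain ⟨t, ht, e⟩ := h.eigenvalue_pos (sub_ne_zero.2 hne) hy
  have := Complex.ofReal_injective e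
  linarith

/-- An orthonormal basis of eigenvectors of `Γ₀` is a singular-vector decomposition. -/
theorem isSingularDecomposition {ι : Type*} {v : ι → H₀} {s : ι → ℝ} (hv : Orthonormal ℂ v)
    (hspan : (Submodule.span ℂ (Set.range v))ᗮ = ⊥) (hs : ∀ q, 0 < s q)
    (he : ∀ q, Γ₀ (v q) = (s q : ℂ) • v q) :
    IsSingularDecomposition Γ₀ (fun q => s q ^ 2) v v ∧
      IsSingularDecomposition Γ (fun q => s q ^ 2) (fun q => U₁ (v q)) fun q => U₂ (v q) := by
  have hsum : ∀ x, HasSum (fun q => ((Real.sqrt (s q ^ 2) : ℂ) * ⟪v q, x⟫_ℂ) • v q) (Γ₀ x) := by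
    intro x
    have h1 := ((HilbertBasis.mkOfOrthogonalEqBot hv hspan).hasSum_repr x).mapL Γ₀
    simp only [HilbertBasis.repr_apply_apply, HilbertBasis.coe_mkOfOrthogonalEqBot, map_smul, he,
      smul_smul] at h1
    convert h1 using 3 with q
    rw [Real.sqrt_sq (hs q).le, mul_comm]
  refine ⟨⟨fun q => pow_pos (hs q) 2, hv, hv, hsum⟩, fun q => pow_pos (hs q) 2,
    hv.comp_linearIsometry U₁, hv.comp_linearIsometry U₂, fun y => ?_⟩
  -- Γ kills the complement of M, and M is the range of U₂; so the expansion of Γ y is the U₁-image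
  -- of that of Γ₀ x, where U₂x is the projection of y.
  set M := (LinearMap.range (ContinuousLinearMap.adjoint Γ : H₁ →ₗ[ℂ] H₂)).topologicalClosure
    with hM
  have := hasOrthogonalProjection_of_isClosed (K := M) (Submodule.isClosed_topologicalClosure _)
  have hortho : ∀ z ∈ Mᗮ, Γ z = 0 := by
    intro z hz
    refine ext_inner_left ℂ fun u => ?_
    rw [inner_zero_right, ← ContinuousLinearMap.adjoint_inner_left]
    exact hz _ (Submodule.le_topologicalClosure _ ⟨u, rfl⟩)
  have hy := M.sub_starProjection_mem_orthogonal y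
  obtain ⟨x, hx⟩ : ∃ x, U₂ x = M.starProjection y := by
    have h1 : M.starProjection y ∈ LinearMap.range U₂.toLinearMap := by
      rw [h.range₂]; exact M.starProjection_apply_mem y
    exact h1
  rw [← hx] at hy
  have e1 : Γ y = U₁ (Γ₀ x) := by
    have := hortho _ hy
    rw [map_sub, sub_eq_zero] at this
    rw [this, h.eq₁]
  have e2 : ∀ q, ⟪U₂ (v q), y⟫_ℂ = ⟪v q, x⟫_ℂ := by
    intro q
    have hq : U₂ (v q) ∈ M := by rw [hM, ← h.range₂]; exact ⟨v q, rfl⟩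
    have := hy _ hq
    rw [inner_sub_right, sub_eq_zero, U₂.inner_map_map] at this
    exact this
  rw [e1]
  have h1 := (hsum x).mapL U₁.toContinuousLinearMap
  simp only [LinearIsometry.coe_toContinuousLinearMap, map_smul] at h1
  simpa only [e2] using h1

/-- Every s-invariant decomposition has an adapted singular-vector decomposition. -/
theorem exists_isSingularDecomposition [TopologicalSpace.SeparableSpace H₁]
    {Ω₁ : H₁ →ₗ.[ℂ] H₁} {Ω₂ : H₂ →ₗ.[ℂ] H₂} (hΩ₁ : IsSelfAdjoint Ω₁) (hΩ₂ : IsSelfAdjoint Ω₂)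
    (hpp : HasPurePointSpectrum Γ₀) {κ : Type*} {K₁ : κ → Submodule ℂ H₁}
    {K₂ : κ → Submodule ℂ H₂} (hK : IsSInvariantDecomposition Ω₁ Ω₂ Γ K₁ K₂) :
    ∃ (ι : Type) (_ : Countable ι) (γ : ι → ℝ) (g₀ : ι → H₀),
      IsSingularDecomposition Γ₀ γ g₀ g₀ ∧
      IsSingularDecomposition Γ γ (fun q => U₁ (g₀ q)) (fun q => U₂ (g₀ q)) ∧
      ∀ q, ∃ α, U₁ (g₀ q) ∈ K₁ α ∧ U₂ (g₀ q) ∈ K₂ α := by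
  have : TopologicalSpace.SeparableSpace H₀ := by
    have := UniformSpace.secondCountable_of_separable H₁
    have := U₁.isometry.isEmbedding.secondCountableTopology
    infer_instance
  let E : ℂ → Submodule ℂ H₀ := Module.End.eigenspace (Γ₀ : Module.End ℂ H₀)
  have hE : ∀ {μ x}, x ∈ E μ ↔ Γ₀ x = μ • x := Module.End.mem_eigenspace_iff
  have hEcl : ∀ μ, IsClosed (E μ : Set H₀) := by
    intro μ
    have : (E μ : Set H₀) = {x | Γ₀ x = μ • x} := Set.ext fun x => hE
    rw [this]
    exact isClosed_eq (by fun_prop) (by fun_prop)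
  let M : ℂ × κ → Submodule ℂ H₀ := fun i => E i.1 ⊓ (K₁ i.2).comap U₁.toLinearMap
  have hMcl : ∀ i, IsClosed (M i : Set H₀) := fun i =>
    (hEcl i.1).inter ((hK.decomposition₁.closed i.2).preimage U₁.continuous)
  have hMortho : ∀ i j, i ≠ j → M i ⟂ M j := by
    rintro ⟨μ, α⟩ ⟨ν, β⟩ hne
    rw [Submodule.isOrtho_iff_inner_eq]
    rintro x ⟨hx, hxα⟩ y ⟨hy, hyβ⟩
    by_cases hμ : μ = ν
    · subst hμ
      have hαβ : α ≠ β := fun e => hne (by rw [e])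
      rw [← U₁.inner_map_map]
      exact Submodule.isOrtho_iff_inner_eq.1 (hK.decomposition₁.ortho α β hαβ) _ hxα _ hyβ
    · by_cases hx0 : x = 0
      · rw [hx0, inner_zero_left]
      obtain ⟨s, -, e⟩ := h.eigenvalue_pos hx0 (hE.1 hx)
      have h1 := h.inner_symm x y
      rw [hE.1 hx, hE.1 hy, inner_smul_left, inner_smul_right] at h1
      simp only at e
      rw [e, Complex.conj_ofReal, ← e] at h1
      have h2 : (μ - ν) * ⟪x, y⟫_ℂ = 0 := by linear_combination h1
      exact (mul_eq_zero.1 h2).resolve_left (sub_ne_zero.2 hμ)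
  have hMtot : ∀ x, (∀ i, x ∈ (M i)ᗮ) → x = 0 := by
    intro x hx
    have hbot : (⨆ μ, E μ)ᗮ = ⊥ := Submodule.topologicalClosure_eq_top_iff.1 hpp
    rw [← Submodule.mem_bot ℂ, ← hbot, ← Submodule.iInf_orthogonal, Submodule.mem_iInf]
    intro μ
    have := hasOrthogonalProjection_of_isClosed (hEcl μ)
    rw [← Submodule.starProjection_apply_eq_zero_iff]
    have hz := (E μ).starProjection_apply_mem x
    have hzx := (E μ).sub_starProjection_mem_orthogonal x
    set z := (E μ).starProjection x
    -- Each component of U₁z is U₁z' with z' in M (μ, α). As z' is orthogonal to x and lies in E μ,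
    -- it is orthogonal to z, so that component has norm zero.
    have hU : U₁ z = 0 := by
      refine hK.decomposition₁.eq_zero fun α => ?_
      have := hasOrthogonalProjection_of_isClosed (hK.decomposition₁.closed α)
      have := hasOrthogonalProjection_of_isClosed (hK.decomposition₂.closed α)
      obtain ⟨-, -, m₁, m₂⟩ := hK.isInvariant hΩ₁ hΩ₂ α
      obtain ⟨z', hz', he⟩ := h.exists_component m₁ m₂ (hE.1 hz)
      have hzM : z' ∈ M (μ, α) := ⟨hE.2 he, by
        change U₁ z' ∈ K₁ α
        rw [hz']
        exact (K₁ α).starProjection_apply_mem _⟩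
      have h1 : ⟪z', z⟫_ℂ = 0 := by
        have a1 := hx (μ, α) z' hzM
        have a2 := hzx z' hzM.1
        rwa [inner_sub_right, a1, zero_sub, neg_eq_zero] at a2
      have h2 : ⟪(K₁ α).starProjection (U₁ z), U₁ z⟫_ℂ = 0 := by
        rw [← hz', U₁.inner_map_map, h1]
      rw [← Submodule.starProjection_apply_eq_zero_iff, ← inner_self_eq_zero (𝕜 := ℂ)]
      have h3 := (K₁ α).sub_starProjection_mem_orthogonal (U₁ z) _
        ((K₁ α).starProjection_apply_mem (U₁ z))
      rwa [inner_sub_right, h2, zero_sub, neg_eq_zero] at h3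
    exact U₁.injective (by rw [hU, map_zero])
  obtain ⟨ι, hι, v, hv, hspan, hmem⟩ := exists_orthonormal_subordinate hMcl hMortho hMtot
  choose i hi using hmem
  choose s hs0 hs using fun q => h.eigenvalue_pos (hv.ne_zero q) (hE.1 (hi q).1)
  have he : ∀ q, Γ₀ (v q) = (s q : ℂ) • v q := fun q => by rw [← hs]; exact hE.1 (hi q).1
  obtain ⟨d₀, d⟩ := h.isSingularDecomposition hv hspan hs0 he
  exact ⟨ι, hι, _, v, d₀, d, fun q => ⟨(i q).2, (hi q).2,
    d.right_mem (hK.isInvariant hΩ₁ hΩ₂ _).2.2.2 (hi q).2⟩⟩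

end IsStandardRepresentation

end Representation

end OpenSystem

end

theorem mainTheorem4 {H₁ H₂ H₀ : Type*}
    [NormedAddCommGroup H₁] [InnerProductSpace ℂ H₁] [CompleteSpace H₁]
    [TopologicalSpace.SeparableSpace H₁]
    [NormedAddCommGroup H₂] [InnerProductSpace ℂ H₂] [CompleteSpace H₂]
    [TopologicalSpace.SeparableSpace H₂]
    [NormedAddCommGroup H₀] [InnerProductSpace ℂ H₀] [CompleteSpace H₀]
    (Ω₁ : H₁ →ₗ.[ℂ] H₁) (hΩ₁ : IsSelfAdjoint Ω₁)
    (Ω₂ : H₂ →ₗ.[ℂ] H₂) (hΩ₂ : IsSelfAdjoint Ω₂)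
    (Γ : H₂ →L[ℂ] H₁)
    (U₁ : H₀ →ₗᵢ[ℂ] H₁) (U₂ : H₀ →ₗᵢ[ℂ] H₂) (Γ₀ : H₀ →L[ℂ] H₀)
    (hrep : OpenSystem.IsStandardRepresentation Γ U₁ U₂ Γ₀)
    (hpp : OpenSystem.HasPurePointSpectrum Γ₀) :
    -- every s-invariant splitting admits an adapted decomposition of `Γ₀` and `Γ`
    (∀ {κ : Type*} (K₁ : κ → Submodule ℂ H₁) (K₂ : κ → Submodule ℂ H₂),
      OpenSystem.IsSInvariantDecomposition Ω₁ Ω₂ Γ K₁ K₂ →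
      ∃ (ι : Type) (_ : Countable ι) (γ : ι → ℝ) (g₀ : ι → H₀),
        OpenSystem.IsSingularDecomposition Γ₀ γ g₀ g₀ ∧
        OpenSystem.IsSingularDecomposition Γ γ (fun q => U₁ (g₀ q)) (fun q => U₂ (g₀ q)) ∧
        ∀ q, ∃ α, U₁ (g₀ q) ∈ K₁ α ∧ U₂ (g₀ q) ∈ K₂ α) ∧
    -- in a reconstructible system the channel graph gives the finest compatible decomposition
    (OpenSystem.IsReconstructible Ω₁ Ω₂ Γ →
      ∀ {ι : Type*} [Countable ι] (γ : ι → ℝ) (g : ι → H₁) (g' : ι → H₂),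
        OpenSystem.IsSingularDecomposition Γ γ g g' →
        OpenSystem.IsSInvariantDecomposition Ω₁ Ω₂ Γ
          (OpenSystem.componentOrbit Ω₁ g (OpenSystem.channelGraph Ω₁ Ω₂ g g'))
          (OpenSystem.componentOrbit Ω₂ g' (OpenSystem.channelGraph Ω₁ Ω₂ g g')) ∧
        (∀ q, ∃ c, g q ∈ OpenSystem.componentOrbit Ω₁ g
          (OpenSystem.channelGraph Ω₁ Ω₂ g g') c) ∧
        ∀ {κ : Type*} (L₁ : κ → Submodule ℂ H₁) (L₂ : κ → Submodule ℂ H₂),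
          OpenSystem.IsSInvariantDecomposition Ω₁ Ω₂ Γ L₁ L₂ →
          (∀ q, ∃ β, g q ∈ L₁ β) →
          ∀ c, ∃ β,
            OpenSystem.componentOrbit Ω₁ g (OpenSystem.channelGraph Ω₁ Ω₂ g g') c ≤ L₁ β ∧
            OpenSystem.componentOrbit Ω₂ g' (OpenSystem.channelGraph Ω₁ Ω₂ g g') c ≤ L₂ β) ∧
    -- simple singular values: the finest s-invariant decomposition is unique
    (OpenSystem.IsReconstructible Ω₁ Ω₂ Γ →
      (∀ μ : ℂ, μ ≠ 0 →
        Module.End.HasEigenvalue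
          ((Γ ∘L ContinuousLinearMap.adjoint Γ : H₁ →L[ℂ] H₁) : Module.End ℂ H₁) μ →
        Module.finrank ℂ (Module.End.eigenspace
          ((Γ ∘L ContinuousLinearMap.adjoint Γ : H₁ →L[ℂ] H₁) : Module.End ℂ H₁) μ) = 1) →
      ∃! D : Set (Submodule ℂ H₁ × Submodule ℂ H₂),
        OpenSystem.IsFinestDecomposition Ω₁ Ω₂ Γ D) := by
  refine ⟨fun K₁ K₂ hK => hrep.exists_isSingularDecomposition hΩ₁ hΩ₂ hpp hK,
    fun hr ι _ γ g g' hS =>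
      ⟨OpenSystem.isSInvariantDecomposition_componentOrbit hΩ₁ hΩ₂ hr hS, fun q =>
        ⟨_, OpenSystem.subset_orbit hΩ₁ _ ⟨q, rfl, rfl⟩⟩, fun L₁ L₂ hL hg c =>
        OpenSystem.exists_componentOrbit_le hΩ₁ hΩ₂ hS hL hg c⟩, fun hr hsimple => ?_⟩
  -- The one-summand decomposition serves only to produce some singular-vector decomposition of Γ.
  obtain ⟨ι, -, γ, g₀, -, hS, -⟩ := hrep.exists_isSingularDecomposition hΩ₁ hΩ₂ hpp
    (OpenSystem.isSInvariantDecomposition_top (Γ := Γ) hΩ₁ hΩ₂)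
  exact OpenSystem.existsUnique_isFinestDecomposition hΩ₁ hΩ₂ hr hsimple hS
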